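/- Let $n\ge 1$ and write $\mathbb R^*=\mathbb R\setminus\{0\}$. Let $C^*(\mathbb R^{2n})\subset B(L^2(\mathbb R^{2n}))$ be the $C^*$-algebra generated by the convolution operators $\xi\mapsto f*\xi$, $f\in L^1(\mathbb R^{2n})$, and let $h\mapsto \hat h\in C_0(\mathbb R^{2n})$ be the continuous extension to $C^*(\mathbb R^{2n})$ of the Fourier transform $\hat f(u)=\int_{\mathbb R^{2n}} f(x)e^{-2\pi i x\cdot u}\,dx$ of $L^1(\mathbb R^{2n})$. Let $\mathcal F_n$ be the $C^*$-algebra of all operator fields $F=(F(\lambda))_{\lambda\in\mathbb R}$ such that $F(0)\in C^*(\mathbb R^{2n})$, $F(\lambda)$ is a compact operator on $L^2(\mathbb R^n)$ for every $\lambda\in\mathbb R^*$, the map $\mathbb R^*\ni\lambda\mapsto F(\lambda)\in B(L^2(\mathbb R^n))$ is bounded and norm continuous, and $\|F(\lambda)\|_{op}\to0$ as $|\lambda|\to\infty$; its norm is $\|F\|=\sup_{\lambda\in\mathbb R}\|F(\lambda)\|$. Fix a Schwartz function $\eta\in\mathcal S(\mathbb R^n)$ with $\|\eta\|_2=1$,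 and for $\lambda\in\mathbb R^*$ and $a,b\in\mathbb R^n$ put $$\eta(\lambda,a,b)(s)=|\lambda|^{n/4}e^{2\pi i a\cdot s}\,\eta\bigl(|\lambda|^{1/2}(s+\tfrac b\lambda)\bigr),\qquad s\in\mathbb R^n.$$ Let $P_\xi$ be the orthogonal projection of $L^2(\mathbb R^n)$ onto $\mathbb C\xi$. For $\lambda\in\mathbb R^*$ let $\nu_\lambda: C^*(\mathbb R^{2n})\to B(L^2(\mathbb R^n))$ be the extension by continuity of $$\nu_\lambda(h)=\int_{\mathbb R^{2n}}\hat h(u)\,P_{\eta(\lambda,u)}\,\frac{du}{|\lambda|^n},\qquad h\in\mathcal S(\mathbb R^{2n}),$$ where the integral converges in operator norm. Then $\nu(h)(\lambda)=\nu_\lambda(h)$ for $\lambda\in\mathbb R^*$, $\nu(h)(0)=h$, defines a bounded linear map $\nu:C^*(\mathbb R^{2n})\to\mathcal F_n$, and it has the following properties. 1. $\|\nu\|=1$. 2. For all $h,h'\in C^*(\mathbb R^{2n})$, $$\lim_{\lambda\to0}\|\nu_\lambda(h\cdot h')-\nu_\lambda(h)\circ\nu_\lambda(h')\|_{op}=0\quad\text{and}\quad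 \lim_{\lambda\to0}\|\nu_\lambda(h^*)-\nu_\lambda(h)^*\|_{op}=0.$$ 3. For all $(a,b)\in\mathbb R^{2n}$ and $h\in C^*(\mathbb R^{2n})$, $$\lim_{\lambda\to0}\|\nu(h)(\lambda)\eta(\lambda,a,b)-\hat h(a,b)\eta(\lambda,a,b)\|_2=0.$$ 4. For all $h\in C^*(\mathbb R^{2n})$, $\lim_{\lambda\to0}\|\nu(h)(\lambda)\|=\|\hat h\|_\infty$. -/

import Mathlib

open MeasureTheory Filter Topology
open scoped FourierTransform SchwartzMap ZeroAtInfty InnerProductSpace BoundedContinuousFunction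

noncomputable section

namespace HeisenbergCStar

/-- `ℝⁿ` with its Euclidean structure and Lebesgue measure. -/
abbrev Rn (n : ℕ) : Type := EuclideanSpace ℝ (Fin n)

/-- `ℝ²ⁿ = ℝⁿ × ℝⁿ`, with the Euclidean norm and Lebesgue measure; its points are `u = (a, b)`. -/
abbrev R2n (n : ℕ) : Type := WithLp 2 (Rn n × Rn n)

/-- `ℝ^* = ℝ \ {0}`. -/
abbrev Rstar : Type := {t : ℝ // t ≠ 0}

/-- The Hilbert space `L²(ℝⁿ)`. -/
abbrev L2Rn (n : ℕ) : Type := Lp ℂ 2 (volume : Measure (Rn n))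

/-- The Hilbert space `L²(ℝ²ⁿ)`. -/
abbrev L2R2n (n : ℕ) : Type := Lp ℂ 2 (volume : Measure (R2n n))

/-- The filter on `ℝ^*` of `λ → 0`. -/
def nearZero : Filter Rstar := comap Subtype.val (𝓝 (0 : ℝ))

/-- The filter on `ℝ^*` of `λ → ∞`, that is `|λ| → ∞`. -/
def nearInfinity : Filter Rstar := comap (fun l => |l.1|) atTop

/-! ### The C⋆-algebra of `ℝ²ⁿ` -/

/-- Translation on `L²(ℝ²ⁿ)`: `(τ_v ξ)(x) = ξ(x - v)`. -/
def translate {n : ℕ} (v : R2n n) (ξ : L2R2n n) : L2R2n n :=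
  Lp.compMeasurePreserving (fun x => x - v) (measurePreserving_sub_right volume v) ξ

theorem norm_translate {n : ℕ} (v : R2n n) (ξ : L2R2n n) : ‖translate v ξ‖ = ‖ξ‖ :=
  Lp.norm_compMeasurePreserving _ _

theorem continuous_translate {n : ℕ} (ξ : L2R2n n) :
    Continuous (fun v : R2n n => translate v ξ) := by
  let g : C(R2n n, C(R2n n, R2n n)) :=
    (ContinuousMap.mk (fun p : R2n n × R2n n => p.2 - p.1)
      (continuous_snd.sub continuous_fst)).curry
  exact (continuous_const (y := ξ)).compMeasurePreservingLp g.continuous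
    (fun v => measurePreserving_sub_right volume v) (by norm_num)

theorem integrable_smul_translate {n : ℕ} (f : R2n n →₁[volume] ℂ) (ξ : L2R2n n) :
    Integrable (fun v : R2n n => f v • translate v ξ) := by
  refine ((L1.integrable_coeFn f).norm.mul_const ‖ξ‖).mono' ?_ ?_
  · exact (L1.integrable_coeFn f).aestronglyMeasurable.smul (continuous_translate ξ).aestronglyMeasurable
  · exact Eventually.of_forall fun v => by rw [norm_smul, norm_translate]

/-- The convolution operator `ξ ↦ f ∗ ξ = ∫ f(v) τ_v ξ dv` on `L²(ℝ²ⁿ)` for `f ∈ L¹(ℝ²ⁿ)`. -/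
def convOp {n : ℕ} (f : R2n n →₁[volume] ℂ) : L2R2n n →L[ℂ] L2R2n n :=
  LinearMap.mkContinuous
    { toFun := fun ξ => ∫ v : R2n n, f v • translate v ξ
      map_add' := fun ξ ζ => by
        rw [← integral_add (integrable_smul_translate f ξ) (integrable_smul_translate f ζ)]
        congr 1 with v : 1
        rw [← smul_add]
        congr 1
        exact map_add (Lp.compMeasurePreserving (fun x => x - v)
          (measurePreserving_sub_right volume v)) ξ ζ
      map_smul' := fun c ξ => by
        rw [RingHom.id_apply, ← integral_smul]
        congr 1 with v : 1
        rw [show translate v (c • ξ) = c • translate v ξ from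
          map_smul (Lp.compMeasurePreservingₗ ℂ (fun x => x - v)
            (measurePreserving_sub_right volume v)) c ξ]
        exact smul_comm _ _ _ }
    ‖f‖ fun ξ => by
      refine (norm_integral_le_integral_norm _).trans ?_
      simp only [norm_smul, norm_translate]
      rw [integral_mul_const, ← L1.norm_eq_integral_norm]

/-- The C⋆-algebra of operators on `L²(ℝ²ⁿ)` generated by the convolution operators with functions
in `L¹(ℝ²ⁿ)`. -/
def convAlgebra (n : ℕ) : NonUnitalStarSubalgebra ℂ (L2R2n n →L[ℂ] L2R2n n) :=
  (NonUnitalStarAlgebra.adjoin ℂ (Set.range (convOp (n := n)))).topologicalClosure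

theorem convOp_mem {n : ℕ} (f : R2n n →₁[volume] ℂ) : convOp f ∈ convAlgebra n :=
  NonUnitalStarSubalgebra.le_topologicalClosure _
    (NonUnitalStarAlgebra.subset_adjoin ℂ _ ⟨f, rfl⟩)

/-- `C⋆(ℝ²ⁿ)`, the group C⋆-algebra of `ℝ²ⁿ` as an algebra of convolution operators. -/
def CStarR2n (n : ℕ) : Type := convAlgebra n

/-- The norm is the operator norm, the product is the composition of operators and the involution
is the Hilbert space adjoint. -/
instance instNonUnitalCStarAlgebraCStarR2n (n : ℕ) : NonUnitalCStarAlgebra (CStarR2n n) :=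
  NonUnitalStarSubalgebra.nonUnitalCStarAlgebra (convAlgebra n)
    (h_closed := NonUnitalStarSubalgebra.isClosed_topologicalClosure _)

/-- The embedding `L¹(ℝ²ⁿ) → C⋆(ℝ²ⁿ)`. -/
def ofL1 {n : ℕ} (f : R2n n →₁[volume] ℂ) : CStarR2n n := ⟨convOp f, convOp_mem f⟩

/-- The embedding `𝓢(ℝ²ⁿ) → C⋆(ℝ²ⁿ)`. -/
def ofSchwartz {n : ℕ} (f : 𝓢(R2n n, ℂ)) : CStarR2n n := ofL1 (f.toLp 1)

/-- The Fourier transform `f̂(u) = ∫ f(x) exp(-2πi x·u) dx` of `f ∈ L¹(ℝ²ⁿ)`, as an element of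
`C₀(ℝ²ⁿ)`. -/
def fourierL1 {n : ℕ} (f : R2n n →₁[volume] ℂ) : C₀(R2n n, ℂ) where
  toFun := 𝓕 (f : R2n n → ℂ)
  continuous_toFun :=
    VectorFourier.fourierIntegral_continuous Real.continuous_fourierChar continuous_inner
      (L1.integrable_coeFn f)
  zero_at_infty' := tendsto_integral_exp_inner_smul_cocompact (f : R2n n → ℂ)

/-- The Fourier (Gelfand) transform `h ↦ ĥ`, `C⋆(ℝ²ⁿ) → C₀(ℝ²ⁿ)`: the extension by continuity of
the Fourier transform of `L¹(ℝ²ⁿ)`. -/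
def hat {n : ℕ} (h : CStarR2n n) : C₀(R2n n, ℂ) :=
  limUnder (comap ofL1 (𝓝 h)) fourierL1

/-! ### The C⋆-algebra of operator fields -/

theorem isCompactOperator_star {H : Type*} [NormedAddCommGroup H] [InnerProductSpace ℂ H]
    [CompleteSpace H] {T : H →L[ℂ] H} (hT : IsCompactOperator T) :
    IsCompactOperator (star T : H →L[ℂ] H) := by
  have hc : IsCompactOperator (T ∘L star T) := hT.comp_clm (star T)
  refine (isCompactOperator_iff_isCompact_closure_image_closedBall (star T).toLinearMap
    zero_lt_one).2 ?_
  have htb : TotallyBounded ((T ∘L star T) '' Metric.closedBall 0 1) :=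
    ((isCompactOperator_iff_isCompact_closure_image_closedBall (T ∘L star T).toLinearMap
      zero_lt_one).1 hc).totallyBounded.subset subset_closure
  refine TotallyBounded.isCompact_of_isClosed (TotallyBounded.closure ?_) isClosed_closure
  refine Metric.totallyBounded_iff.2 fun ε hε => ?_
  obtain ⟨t, hts, htf, ht⟩ := htb.exists_subset
    (Metric.dist_mem_uniformity (show (0 : ℝ) < ε ^ 2 / 2 by positivity))
  obtain ⟨r, hrs, hrf, rfl⟩ := Set.exists_subset_image_finite_and.1 ⟨t, hts, htf, rfl⟩
  refine ⟨(star T : H →L[ℂ] H) '' r, hrf.image _, ?_⟩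
  rintro _ ⟨x, hx, rfl⟩
  obtain ⟨_, ⟨y, hy, rfl⟩, hxy⟩ := Set.mem_iUnion₂.1 (ht ⟨x, hx, rfl⟩)
  refine Set.mem_iUnion₂.2 ⟨star T y, ⟨y, hy, rfl⟩, ?_⟩
  have hx1 : ‖x‖ ≤ 1 := by simpa using hx
  have hy1 : ‖y‖ ≤ 1 := by simpa using hrs hy
  have hd : ‖T (star T (x - y))‖ < ε ^ 2 / 2 := by
    have : dist (T (star T x)) (T (star T y)) < ε ^ 2 / 2 := hxy
    rwa [dist_eq_norm, ← map_sub, ← map_sub] at this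
  have hsq : ‖star T (x - y)‖ ^ 2 ≤ ‖x - y‖ * ‖T (star T (x - y))‖ := by
    have h := norm_inner_le_norm (𝕜 := ℂ) (x - y) (T (star T (x - y)))
    rw [← ContinuousLinearMap.adjoint_inner_left, ← ContinuousLinearMap.star_eq_adjoint,
      inner_self_eq_norm_sq_to_K] at h
    simpa using h
  have h2 : ‖x - y‖ ≤ 2 := (norm_sub_le x y).trans (by linarith)
  have h3 : ‖star T (x - y)‖ ^ 2 < ε ^ 2 := by
    nlinarith [norm_nonneg (T (star T (x - y))), norm_nonneg (x - y)]
  have h4 : ‖star T (x - y)‖ < ε := lt_of_pow_lt_pow_left₀ 2 hε.le h3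
  rw [map_sub] at h4
  simpa [dist_eq_norm] using h4

/-- The C⋆-algebra of all operator fields `(F(λ))_{λ ∈ ℝ}` with `F(0) ∈ C⋆(ℝ²ⁿ)` for which
`λ ↦ F(λ) ∈ B(L²(ℝⁿ))` is bounded and norm continuous on `ℝ^*`. The first component of a pair is
`F(0)`, the second one is the restriction to `ℝ^*`. The operations are pointwise and the norm is
`‖F‖ = sup_{λ ∈ ℝ} ‖F(λ)‖`. -/
def BddFields (n : ℕ) : Type := CStarR2n n × (Rstar →ᵇ (L2Rn n →L[ℂ] L2Rn n))

instance instNonUnitalCStarAlgebraBddFields (n : ℕ) : NonUnitalCStarAlgebra (BddFields n) :=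
  inferInstanceAs (NonUnitalCStarAlgebra (CStarR2n n × (Rstar →ᵇ (L2Rn n →L[ℂ] L2Rn n))))

/-- The operator fields in `BddFields n` with `F(λ)` a compact operator for every `λ ≠ 0` and with
`‖F(λ)‖ → 0` as `|λ| → ∞`. -/
def opFieldsAlgebra (n : ℕ) : NonUnitalStarSubalgebra ℂ (BddFields n) where
  carrier := {F | (∀ l : Rstar, IsCompactOperator (F.2 l)) ∧
    Tendsto (fun l : Rstar => ‖F.2 l‖) nearInfinity (𝓝 0)}
  zero_mem' := ⟨fun _ => isCompactOperator_zero, by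
    change Tendsto (fun _ : Rstar => ‖(0 : L2Rn n →L[ℂ] L2Rn n)‖) nearInfinity (𝓝 0)
    simpa using tendsto_const_nhds⟩
  add_mem' := fun {F G} hF hG => ⟨fun l => (hF.1 l).add (hG.1 l),
    squeeze_zero (fun _ => norm_nonneg _) (fun l => norm_add_le (F.2 l) (G.2 l))
      (by simpa using hF.2.add hG.2)⟩
  mul_mem' := fun {F G} hF hG => ⟨fun l => (hF.1 l).comp_clm (G.2 l),
    squeeze_zero (fun _ => norm_nonneg _) (fun l => norm_mul_le (F.2 l) (G.2 l))
      (by simpa using hF.2.mul hG.2)⟩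
  smul_mem' := fun c F hF => ⟨fun l => (hF.1 l).smul c, by
    have := hF.2.const_mul ‖c‖
    rw [mul_zero] at this
    exact this.congr fun l => (norm_smul c (F.2 l)).symm⟩
  star_mem' := fun {F} hF => ⟨fun l => isCompactOperator_star (hF.1 l),
    hF.2.congr fun l => (norm_star (F.2 l)).symm⟩

theorem isClosed_opFieldsAlgebra (n : ℕ) : IsClosed (opFieldsAlgebra n : Set (BddFields n)) := by
  refine isClosed_of_closure_subset fun F hF => ?_
  have key : ∀ ε > 0, ∃ G ∈ opFieldsAlgebra n, ∀ l : Rstar, ‖F.2 l - G.2 l‖ < ε := by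
    intro ε hε
    obtain ⟨G, hG, hFG⟩ := Metric.mem_closure_iff.1 hF ε hε
    refine ⟨G, hG, fun l => ?_⟩
    rw [dist_eq_norm] at hFG
    exact lt_of_le_of_lt (((F - G).2.norm_coe_le_norm l).trans (le_max_right _ _)) hFG
  constructor
  · intro l
    have hc := isClosed_setOfPred_isCompactOperator (𝕜₁ := ℂ) (𝕜₂ := ℂ) (σ₁₂ := RingHom.id ℂ)
      (M₁ := L2Rn n) (M₂ := L2Rn n)
    refine hc.closure_subset (Metric.mem_closure_iff.2 fun ε hε => ?_)
    obtain ⟨G, hG, hFG⟩ := key ε hε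
    exact ⟨G.2 l, hG.1 l, by rw [dist_eq_norm]; exact hFG l⟩
  · rw [Metric.tendsto_nhds]
    intro ε hε
    obtain ⟨G, hG, hFG⟩ := key (ε / 2) (half_pos hε)
    filter_upwards [Metric.tendsto_nhds.1 hG.2 (ε / 2) (half_pos hε)] with l hl
    simp only [dist_zero_right, norm_norm] at hl ⊢
    have := norm_add_le (F.2 l - G.2 l) (G.2 l)
    rw [sub_add_cancel] at this
    linarith [hFG l]

/-- The C⋆-algebra `𝓕_n` of operator fields. -/
def OpFields (n : ℕ) : Type := opFieldsAlgebra n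

instance instNonUnitalCStarAlgebraOpFields (n : ℕ) : NonUnitalCStarAlgebra (OpFields n) :=
  NonUnitalStarSubalgebra.nonUnitalCStarAlgebra (opFieldsAlgebra n)
    (h_closed := isClosed_opFieldsAlgebra n)

/-- The value `F(0) ∈ C⋆(ℝ²ⁿ)` of an operator field. -/
def valueZero {n : ℕ} (F : OpFields n) : CStarR2n n := F.1.1

/-- The value `F(λ) ∈ B(L²(ℝⁿ))` of an operator field at `λ ≠ 0`. -/
def valueAt {n : ℕ} (F : OpFields n) (l : Rstar) : L2Rn n →L[ℂ] L2Rn n := F.1.2 l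

/-! ### The operators `ν_λ(h)` -/

/-- The function
`η(λ,a,b)(s) = |λ|^{n/4} exp(2πi a·s) η(|λ|^{1/2}(s + b/λ))`. -/
def etaFun {n : ℕ} (η : 𝓢(Rn n, ℂ)) (l : Rstar) (a b : Rn n) (s : Rn n) : ℂ :=
  ((|l.1| ^ ((n : ℝ) / 4) : ℝ) : ℂ) * Complex.exp (2 * Real.pi * Complex.I * (⟪a, s⟫_ℝ : ℝ)) *
    η (√|l.1| • (s + l.1⁻¹ • b))

theorem memLp_etaFun {n : ℕ} (η : 𝓢(Rn n, ℂ)) (l : Rstar) (a b : Rn n) :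
    MemLp (etaFun η l a b) 2 := by
  have hl : √|l.1| ≠ 0 := (Real.sqrt_pos.2 (abs_pos.2 l.2)).ne'
  have hcont : Continuous (etaFun η l a b) := by
    unfold etaFun
    have := η.continuous
    fun_prop
  rw [memLp_two_iff_integrable_sq_norm hcont.aestronglyMeasurable]
  have h1 : Integrable (fun s : Rn n => ‖η s‖ ^ 2) :=
    (memLp_two_iff_integrable_sq_norm η.continuous.aestronglyMeasurable).1 (η.memLp 2)
  have h2 := ((h1.comp_smul hl).comp_add_right (l.1⁻¹ • b)).const_mul
    (‖((|l.1| ^ ((n : ℝ) / 4) : ℝ) : ℂ)‖ ^ 2)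
  refine h2.congr (Eventually.of_forall fun s => ?_)
  have he : ‖Complex.exp (2 * Real.pi * Complex.I * (⟪a, s⟫_ℝ : ℝ))‖ = 1 := by
    rw [show (2 * Real.pi * Complex.I * (⟪a, s⟫_ℝ : ℝ) : ℂ)
      = ((2 * Real.pi * ⟪a, s⟫_ℝ : ℝ) : ℂ) * Complex.I by push_cast; ring]
    exact Complex.norm_exp_ofReal_mul_I _
  simp only [etaFun, norm_mul, he, mul_one, mul_pow]

/-- `η(λ,a,b)` as an element of `L²(ℝⁿ)`; here `u = (a,b)`. -/
def etaL2 {n : ℕ} (η : 𝓢(Rn n, ℂ)) (l : Rstar) (u : R2n n) : L2Rn n :=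
  (memLp_etaFun η l u.fst u.snd).toLp

/-- The orthogonal projection `P_ξ` of `L²(ℝⁿ)` onto the line `ℂξ`. -/
def lineProj {n : ℕ} (ξ : L2Rn n) : L2Rn n →L[ℂ] L2Rn n := (ℂ ∙ ξ).starProjection

/-- The integrand `f̂(u) P_{η(λ,u)} / |λ|ⁿ` of `ν_λ(f)`, for a Schwartz function `f`. -/
def nuIntegrand {n : ℕ} (η : 𝓢(Rn n, ℂ)) (l : Rstar) (f : 𝓢(R2n n, ℂ)) (u : R2n n) :
    L2Rn n →L[ℂ] L2Rn n :=
  (𝓕 (f : R2n n → ℂ) u / ((|l.1| ^ n : ℝ) : ℂ)) • lineProj (etaL2 η l u)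

/-- The operator `ν_λ(h)`, `h ∈ C⋆(ℝ²ⁿ)`: the extension by continuity from `𝓢(ℝ²ⁿ)` of
`ν_λ(f) = ∫ f̂(u) P_{η(λ,u)} du / |λ|ⁿ` (a Bochner integral for the operator norm). -/
def nuOp {n : ℕ} (η : 𝓢(Rn n, ℂ)) (l : Rstar) (h : CStarR2n n) : L2Rn n →L[ℂ] L2Rn n :=
  limUnder (comap ofSchwartz (𝓝 h)) (fun f : 𝓢(R2n n, ℂ) => ∫ u : R2n n, nuIntegrand η l f u)

end HeisenbergCStar

end

/-!
The operators `ν_λ(h)` are Toeplitz operators. Write `ρ_λ(a, b)` for the time-frequency shift by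
`(a, b/λ)`, so that `η(λ, u) = ρ_λ(u) φ` with the window `φ = η(λ, 0)`, a dilate of `η`. The
orthogonality relations (Plancherel in `a`, then Tonelli) say that the coherent state transform
`(W ξ)(u) = |λ|^{-n/2} ⟨ρ_λ(u) φ, ξ⟩` is an isometry `L²(ℝⁿ) → L²(ℝ²ⁿ)`, and `ν_λ(h) = W⋆ M W`,
where `M` is the multiplication by `ĥ`. This gives `‖ν_λ(h)‖ ≤ ‖ĥ‖_∞` and `ν_λ(h⋆) = ν_λ(h)⋆` at
once.

For the limits `λ → 0`, the point is that multiplication by the plane wave `exp(2πi v·u)` turns `W`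
into a coherent state transform again: there is a time-frequency shift `σ_v` of `L²(ℝⁿ)` with
`σ_v ρ_λ(u) σ_v⁻¹ = exp(2πi v·u) ρ_λ(u)`, so that the product of the plane wave with `W ξ` is the
transform of `σ_v ξ` with window `σ_v φ` in place of `φ`. By the orthogonality relations it differs
from `W σ_v ξ` by exactly `‖σ_v φ - φ‖ ‖ξ‖` (`norm_mulOp_planeWave_coherentOp_sub`). Undoing the
dilation, `σ_v` is a time-frequency shift by a vector of length `O(|λ|^{1/2})`, hence
`‖σ_v φ - φ‖ → 0` (`tendsto_dualShift_etaL2`). If `h = f` is in `L¹`, then `ĥ` is a superposition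
of plane waves with weight `f`, and dominated convergence shows that `M` maps the range of `W` into
itself up to an error that tends to `0` in operator norm. This is multiplicativity
(`norm_toeplitz_mul_sub_le`); the same estimate, together with the fact that `σ_v` acts on
`η(λ, u)` almost as the scalar `exp(2πi v·u)`, makes `η(λ, u)` an approximate eigenvector of
`ν_λ(f)` with eigenvalue `f̂(u)` (`norm_toeplitz_tfShift_sub_le`). The latter and the upper bound
for the norm give the limit of `‖ν_λ(h)‖`. All these statements extend by density, the maps being
uniformly bounded.

On the side of `C⋆(ℝ²ⁿ)`, the Plancherel theorem turns convolution operators into multiplications,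
so that `h` is the Fourier multiplier with symbol `ĥ` (`coe_eq_fourierMul`); in particular
`‖ĥ‖_∞ = ‖h‖`, and `h ↦ ĥ` is multiplicative and compatible with the involutions. That the fields
`λ ↦ ν_λ(f)` belong to `𝓕_n` is read off the integral over the projections `P_{η(λ, u)}` for
Schwartz functions `f`; the algebra `𝓕_n` being complete, `ν` then extends to `C⋆(ℝ²ⁿ)`.
-/

noncomputable section

namespace HeisenbergCStar

/-! ### Generalities on `L²` -/

theorem norm_sq_eq_integral {α : Type*} [MeasurableSpace α] {μ : Measure α} (F : Lp ℂ 2 μ) :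
    ‖F‖ ^ 2 = ∫ x, ‖F x‖ ^ 2 ∂μ := by
  have h : ((‖F‖ ^ 2 : ℝ) : ℂ) = ((∫ x, ‖F x‖ ^ 2 ∂μ : ℝ) : ℂ) := by
    have h1 := inner_self_eq_norm_sq_to_K (𝕜 := ℂ) F
    rw [L2.inner_def] at h1
    simp only [inner_self_eq_norm_sq_to_K] at h1
    rw [← integral_complex_ofReal]
    push_cast
    exact h1.symm
  exact_mod_cast h

theorem integrable_norm_sq {α : Type*} [MeasurableSpace α] {μ : Measure α} (F : Lp ℂ 2 μ) :
    Integrable (fun x => ‖F x‖ ^ 2) μ :=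
  (memLp_two_iff_integrable_sq_norm (Lp.aestronglyMeasurable F)).1 (Lp.memLp F)

theorem lintegral_enorm_sq {α : Type*} [MeasurableSpace α] {μ : Measure α} (F : Lp ℂ 2 μ) :
    ∫⁻ x, ‖F x‖ₑ ^ 2 ∂μ = ENNReal.ofReal (‖F‖ ^ 2) := by
  rw [norm_sq_eq_integral, ofReal_integral_eq_lintegral_ofReal (integrable_norm_sq F)
    (Eventually.of_forall fun x => by positivity)]
  refine lintegral_congr fun x => ?_
  rw [ENNReal.ofReal_pow (norm_nonneg _), ofReal_norm]

/-- In `L²`, pointwise convergence together with constancy of the norms gives norm convergence: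
apply Fatou's lemma to `2|f_i|² + 2|g|² - |f_i - g|² ≥ 0`. -/
theorem tendsto_of_tendsto_ae_of_norm_eq {α ι : Type*} [MeasurableSpace α] {μ : Measure α}
    {l : Filter ι} [l.IsCountablyGenerated] {F : ι → Lp ℂ 2 μ} {G : Lp ℂ 2 μ}
    {f : ι → α → ℂ} {g : α → ℂ} (hF : ∀ i, F i =ᵐ[μ] f i) (hG : G =ᵐ[μ] g)
    (h : ∀ᵐ x ∂μ, Tendsto (fun i => f i x) l (𝓝 (g x))) (hn : ∀ i, ‖F i‖ = ‖G‖) :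
    Tendsto F l (𝓝 G) := by
  rcases l.eq_or_neBot with rfl | hl
  · exact tendsto_bot
  by_cases hG0 : ‖G‖ = 0
  · have h0 : ∀ i, F i = G := fun i => by
      rw [norm_eq_zero.1 hG0, norm_eq_zero.1 ((hn i).trans hG0)]
    simp [funext h0]
  have hGpos : 0 < ‖G‖ ^ 2 := by positivity
  set k : ι → α → ℝ := fun i x => 2 * ‖f i x‖ ^ 2 + 2 * ‖g x‖ ^ 2 - ‖f i x - g x‖ ^ 2 with hk
  have hk0 : ∀ i x, 0 ≤ k i x := fun i x => by
    have := norm_sub_le (f i x) (g x)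
    have h1 : ‖f i x - g x‖ ^ 2 ≤ (‖f i x‖ + ‖g x‖) ^ 2 :=
      pow_le_pow_left₀ (norm_nonneg _) this 2
    simp only [hk]
    nlinarith [sq_nonneg (‖f i x‖ - ‖g x‖)]
  have hkF : ∀ i, k i =ᵐ[μ] fun x => 2 * ‖F i x‖ ^ 2 + 2 * ‖G x‖ ^ 2 - ‖(F i - G) x‖ ^ 2 := by
    intro i
    filter_upwards [hF i, hG, Lp.coeFn_sub (F i) G] with x h1 h2 h3
    simp only [hk, h3, Pi.sub_apply, h1, h2]
  have hint : ∀ i, Integrable (k i) μ := fun i =>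
    ((((integrable_norm_sq (F i)).const_mul 2).add ((integrable_norm_sq G).const_mul 2)).sub
      (integrable_norm_sq (F i - G))).congr (hkF i).symm
  have hval : ∀ i, ∫⁻ x, ENNReal.ofReal (k i x) ∂μ
      = ENNReal.ofReal (4 * ‖G‖ ^ 2 - ‖F i - G‖ ^ 2) := by
    intro i
    rw [← ofReal_integral_eq_lintegral_ofReal (hint i) (Eventually.of_forall (hk0 i)),
      integral_congr_ae (hkF i), integral_sub, integral_add, integral_const_mul,
      integral_const_mul, ← norm_sq_eq_integral, ← norm_sq_eq_integral, ← norm_sq_eq_integral, hn i]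
    · congr 1
      ring
    · exact (integrable_norm_sq (F i)).const_mul 2
    · exact (integrable_norm_sq G).const_mul 2
    · exact ((integrable_norm_sq (F i)).const_mul 2).add ((integrable_norm_sq G).const_mul 2)
    · exact integrable_norm_sq (F i - G)
  have hlim : ∫⁻ x, liminf (fun i => ENNReal.ofReal (k i x)) l ∂μ
      = ENNReal.ofReal (4 * ‖G‖ ^ 2) := by
    have h1 : ∀ᵐ x ∂μ, liminf (fun i => ENNReal.ofReal (k i x)) l
        = ENNReal.ofReal (4 * ‖G x‖ ^ 2) := by
      filter_upwards [h, hG] with x hx hxG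
      have h2 : Tendsto (fun i => k i x) l
          (𝓝 (2 * ‖g x‖ ^ 2 + 2 * ‖g x‖ ^ 2 - ‖g x - g x‖ ^ 2)) :=
        (((hx.norm.pow 2).const_mul 2).add tendsto_const_nhds).sub
          ((hx.sub_const _).norm.pow 2)
      have h3 : Tendsto (fun i => ENNReal.ofReal (k i x)) l _ :=
        (ENNReal.continuous_ofReal.tendsto _).comp h2
      rw [h3.liminf_eq, hxG]
      congr 1
      rw [sub_self, norm_zero]
      ring
    rw [lintegral_congr_ae h1, ← ofReal_integral_eq_lintegral_ofReal
      ((integrable_norm_sq G).const_mul 4) (Eventually.of_forall fun x => by positivity),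
      integral_const_mul, ← norm_sq_eq_integral]
  have hfatou := lintegral_liminf_le' (μ := μ) (u := l) (f := fun i x => ENNReal.ofReal (k i x))
    fun i => (hint i).1.aemeasurable.ennreal_ofReal
  rw [hlim] at hfatou
  simp only [hval] at hfatou
  rw [Metric.tendsto_nhds]
  intro ε hε
  have hlt : ENNReal.ofReal (4 * ‖G‖ ^ 2 - ε ^ 2) < liminf
      (fun i => ENNReal.ofReal (4 * ‖G‖ ^ 2 - ‖F i - G‖ ^ 2)) l :=
    lt_of_lt_of_le ((ENNReal.ofReal_lt_ofReal_iff (by positivity)).2 (by nlinarith)) hfatou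
  filter_upwards [eventually_lt_of_lt_liminf hlt] with i hi
  have := (ENNReal.ofReal_lt_ofReal_iff'.1 hi).1
  rw [dist_eq_norm]
  exact lt_of_pow_lt_pow_left₀ 2 hε.le (by linarith)

/-! ### Multiplication operators and plane waves -/

section Mul

variable {V : Type*} [NormedAddCommGroup V] [InnerProductSpace ℝ V] [FiniteDimensional ℝ V]
  [MeasurableSpace V] [BorelSpace V]

theorem memLp_bcf_mul (g : V →ᵇ ℂ) (F : Lp ℂ 2 (volume : Measure V)) :
    MemLp (fun u => g u * F u) 2 :=
  (Lp.memLp F).of_le_mul (c := ‖g‖)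
    (g.continuous.aestronglyMeasurable.mul (Lp.aestronglyMeasurable F))
    (Eventually.of_forall fun u => by
      rw [norm_mul]
      exact mul_le_mul_of_nonneg_right (g.norm_coe_le_norm u) (norm_nonneg _))

/-- The operator of multiplication by `g` on `L²`, as a function of the bounded continuous
function `g`. -/
def mulOp : (V →ᵇ ℂ) →L[ℂ] Lp ℂ 2 (volume : Measure V) →L[ℂ] Lp ℂ 2 (volume : Measure V) :=
  LinearMap.mkContinuous₂
    (LinearMap.mk₂ ℂ (fun g F => (memLp_bcf_mul g F).toLp)
      (fun g g' F => by
        rw [← MemLp.toLp_add]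
        exact MemLp.toLp_congr _ _ (Eventually.of_forall fun u => add_mul _ _ _))
      (fun c g F => by
        rw [← MemLp.toLp_const_smul]
        exact MemLp.toLp_congr _ _ (Eventually.of_forall fun u => mul_assoc _ _ _))
      (fun g F F' => by
        rw [← MemLp.toLp_add]
        refine MemLp.toLp_congr _ _ ?_
        filter_upwards [Lp.coeFn_add F F'] with u hu
        simp only [hu, Pi.add_apply, mul_add])
      (fun c g F => by
        rw [← MemLp.toLp_const_smul]
        refine MemLp.toLp_congr _ _ ?_
        filter_upwards [Lp.coeFn_smul c F] with u hu
        simp only [hu, Pi.smul_apply, smul_eq_mul, mul_left_comm]))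
    1 fun g F => by
      rw [one_mul]
      refine Lp.norm_le_mul_norm_of_ae_le_mul ?_
      filter_upwards [(memLp_bcf_mul g F).coeFn_toLp] with u hu
      rw [LinearMap.mk₂_apply, hu, norm_mul]
      exact mul_le_mul_of_nonneg_right (g.norm_coe_le_norm u) (norm_nonneg _)

theorem coeFn_mulOp (g : V →ᵇ ℂ) (F : Lp ℂ 2 (volume : Measure V)) :
    mulOp g F =ᵐ[volume] fun u => g u * F u :=
  (memLp_bcf_mul g F).coeFn_toLp

theorem norm_mulOp_le (g : V →ᵇ ℂ) : ‖mulOp g‖ ≤ ‖g‖ := by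
  refine ContinuousLinearMap.opNorm_le_bound _ (norm_nonneg _) fun F => ?_
  refine Lp.norm_le_mul_norm_of_ae_le_mul ?_
  filter_upwards [coeFn_mulOp g F] with u hu
  rw [hu, norm_mul]
  exact mul_le_mul_of_nonneg_right (g.norm_coe_le_norm u) (norm_nonneg _)

theorem inner_mulOp (g : V →ᵇ ℂ) (G F : Lp ℂ 2 (volume : Measure V)) :
    ⟪G, mulOp g F⟫_ℂ = ∫ u, g u * ⟪G u, F u⟫_ℂ := by
  rw [L2.inner_def]
  refine integral_congr_ae ?_
  filter_upwards [coeFn_mulOp g F] with u hu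
  rw [hu, ← smul_eq_mul, inner_smul_right]

theorem mulOp_mul (g g' : V →ᵇ ℂ) (F : Lp ℂ 2 (volume : Measure V)) :
    mulOp (g * g') F = mulOp g (mulOp g' F) := by
  refine Lp.ext ?_
  filter_upwards [coeFn_mulOp (g * g') F, coeFn_mulOp g (mulOp g' F), coeFn_mulOp g' F]
    with u h1 h2 h3
  rw [h1, h2, h3, BoundedContinuousFunction.mul_apply, mul_assoc]

theorem inner_mulOp_star (g : V →ᵇ ℂ) (G F : Lp ℂ 2 (volume : Measure V)) :
    ⟪G, mulOp (star g) F⟫_ℂ = ⟪mulOp g G, F⟫_ℂ := by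
  rw [inner_mulOp, L2.inner_def]
  refine integral_congr_ae ?_
  filter_upwards [coeFn_mulOp g G] with u hu
  rw [hu, ← smul_eq_mul (g u), inner_smul_left]
  rfl

theorem star_mulOp (g : V →ᵇ ℂ) : star (mulOp g) = mulOp (V := V) (star g) := by
  rw [ContinuousLinearMap.star_eq_adjoint]
  refine ((ContinuousLinearMap.eq_adjoint_iff _ _).2 fun F G => ?_).symm
  rw [← inner_conj_symm, inner_mulOp_star, inner_conj_symm]

/-- The plane wave `u ↦ exp(2πi v·u)`. -/
def planeWave (v : V) : V →ᵇ ℂ :=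
  BoundedContinuousFunction.ofNormedAddCommGroup
    (fun u => ((Real.fourierChar ⟪v, u⟫_ℝ : Circle) : ℂ))
    (continuous_subtype_val.comp (Real.continuous_fourierChar.comp
      (continuous_const.inner continuous_id))) 1 fun _ => (Circle.norm_coe _).le

omit [FiniteDimensional ℝ V] [MeasurableSpace V] [BorelSpace V] in
theorem planeWave_apply (v u : V) :
    planeWave v u = ((Real.fourierChar ⟪v, u⟫_ℝ : Circle) : ℂ) := rfl

omit [FiniteDimensional ℝ V] [MeasurableSpace V] [BorelSpace V] in
theorem norm_planeWave_apply (v u : V) : ‖planeWave v u‖ = 1 := Circle.norm_coe _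

theorem norm_mulOp_planeWave (v : V) (F : Lp ℂ 2 (volume : Measure V)) :
    ‖mulOp (planeWave v) F‖ = ‖F‖ := by
  rw [Lp.norm_def, Lp.norm_def]
  congr 1
  refine eLpNorm_congr_norm_ae ?_
  filter_upwards [coeFn_mulOp (planeWave v) F] with u hu
  rw [hu, norm_mul, norm_planeWave_apply, one_mul]

theorem continuous_mulOp_planeWave (F : Lp ℂ 2 (volume : Measure V)) :
    Continuous fun v : V => mulOp (planeWave v) F := by
  refine continuous_iff_continuousAt.2 fun v₀ => ?_
  refine tendsto_of_tendsto_ae_of_norm_eq (fun v => coeFn_mulOp (planeWave v) F)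
    (coeFn_mulOp (planeWave v₀) F) (Eventually.of_forall fun u => ?_)
    fun v => (norm_mulOp_planeWave v F).trans (norm_mulOp_planeWave v₀ F).symm
  refine Tendsto.mul_const _ (Continuous.tendsto ?_ v₀)
  exact continuous_subtype_val.comp (Real.continuous_fourierChar.comp
    (continuous_id.inner continuous_const))

theorem integrable_smul_mulOp_planeWave {f : V → ℂ} (hf : Integrable f)
    (F : Lp ℂ 2 (volume : Measure V)) :
    Integrable fun v : V => f v • mulOp (planeWave (-v)) F := by
  refine (hf.norm.mul_const ‖F‖).mono' (hf.aestronglyMeasurable.smul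
    ((continuous_mulOp_planeWave F).comp continuous_neg).aestronglyMeasurable) ?_
  exact Eventually.of_forall fun v => by rw [norm_smul, norm_mulOp_planeWave]

/-- Multiplication by a Fourier transform `f̂` is the superposition of the multiplications by plane
waves, with weight `f`. -/
theorem mulOp_eq_integral {f : V → ℂ} (hf : Integrable f) {g : V →ᵇ ℂ} (hg : ∀ u, g u = 𝓕 f u)
    (F : Lp ℂ 2 (volume : Measure V)) :
    mulOp g F = ∫ v, f v • mulOp (planeWave (-v)) F := by
  refine ext_inner_left ℂ fun G => ?_
  rw [← integral_inner (integrable_smul_mulOp_planeWave hf F), inner_mulOp]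
  have hk : Integrable (fun u => ⟪G u, F u⟫_ℂ) := L2.integrable_inner G F
  have := VectorFourier.integral_fourierIntegral_smul_eq_flip (μ := volume) (ν := volume)
    (L := innerₗ V) (e := Real.fourierChar) (f := f) (g := fun u => ⟪G u, F u⟫_ℂ)
    Real.continuous_fourierChar continuous_inner hf hk
  have h1 : ∫ u, g u * ⟪G u, F u⟫_ℂ
      = ∫ u, VectorFourier.fourierIntegral Real.fourierChar volume (innerₗ V) f u •
        ⟪G u, F u⟫_ℂ := by
    refine integral_congr_ae (Eventually.of_forall fun u => ?_)
    simp only [hg, smul_eq_mul]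
    rfl
  rw [h1, this]
  refine integral_congr_ae (Eventually.of_forall fun v => ?_)
  simp only [inner_smul_right, smul_eq_mul]
  rw [inner_mulOp]
  congr 1
  refine integral_congr_ae (Eventually.of_forall fun u => ?_)
  simp only [planeWave_apply, inner_neg_left, LinearMap.flip_apply, innerₗ_apply_apply]
  rfl

/-- An operator `R` is small on the product of `F` with a Fourier transform `f̂` if it is small on the
products of `F` with plane waves. -/
theorem norm_apply_mulOp_le {f : V → ℂ} (hf : Integrable f) {g : V →ᵇ ℂ} (hg : ∀ u, g u = 𝓕 f u)
    (F : Lp ℂ 2 (volume : Measure V))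
    (R : Lp ℂ 2 (volume : Measure V) →L[ℂ] Lp ℂ 2 (volume : Measure V)) {b : V → ℝ}
    (hb : Integrable fun v => ‖f v‖ * b v) (h : ∀ v, ‖R (mulOp (planeWave (-v)) F)‖ ≤ b v) :
    ‖R (mulOp g F)‖ ≤ ∫ v, ‖f v‖ * b v := by
  rw [mulOp_eq_integral hf hg,
    ← ContinuousLinearMap.integral_comp_comm _ (integrable_smul_mulOp_planeWave hf _)]
  refine norm_integral_le_of_norm_le hb (Eventually.of_forall fun v => ?_)
  rw [map_smul, norm_smul]
  exact mul_le_mul_of_nonneg_left (h v) (norm_nonneg _)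

/-- Multiplication by `f̂` acts on `F` almost as the scalar `f̂(u)` if every plane wave acts on `F`
almost as its value at `u`. -/
theorem norm_mulOp_sub_smul_le {f : V → ℂ} (hf : Integrable f) {g : V →ᵇ ℂ}
    (hg : ∀ u, g u = 𝓕 f u) (F : Lp ℂ 2 (volume : Measure V)) (u : V) {b : V → ℝ}
    (hb : Integrable fun v => ‖f v‖ * b v)
    (h : ∀ v, ‖mulOp (planeWave (-v)) F - planeWave (-v) u • F‖ ≤ b v) :
    ‖mulOp g F - g u • F‖ ≤ ∫ v, ‖f v‖ * b v := by
  have hgu : g u • F = ∫ v, (f v * planeWave (-v) u) • F := by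
    rw [integral_smul_const, hg, Real.fourier_eq]
    congr 1
    refine integral_congr_ae (Eventually.of_forall fun v => ?_)
    simp only [planeWave_apply, inner_neg_left, Circle.smul_def, smul_eq_mul]
    ring
  have hint : Integrable fun v => (f v * planeWave (-v) u) • F := by
    refine Integrable.smul_const ?_ _
    have hc : Continuous fun v : V => planeWave (-v) u :=
      continuous_subtype_val.comp (Real.continuous_fourierChar.comp
        (continuous_neg.inner continuous_const))
    exact hf.mul_bdd hc.aestronglyMeasurable (c := 1)
      (Eventually.of_forall fun v => (norm_planeWave_apply _ _).le)
  rw [mulOp_eq_integral hf hg, hgu, ← integral_sub (integrable_smul_mulOp_planeWave hf _) hint]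
  refine norm_integral_le_of_norm_le hb (Eventually.of_forall fun v => ?_)
  rw [← smul_smul, ← smul_sub, norm_smul]
  exact mul_le_mul_of_nonneg_left (h v) (norm_nonneg _)

theorem norm_mulOp (g : V →ᵇ ℂ) : ‖mulOp g‖ = ‖g‖ := by
  refine le_antisymm (norm_mulOp_le g) ((BoundedContinuousFunction.norm_le (norm_nonneg _)).2
    fun u₀ => le_of_not_gt fun hlt => ?_)
  obtain ⟨c, hc1, hc2⟩ := exists_between hlt
  have hc0 : 0 < c := (norm_nonneg _).trans_lt hc1
  -- test `mulOp g` on the indicator function of a small open set where `|g| > c`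
  set S : Set V := {u | c < ‖g u‖} ∩ Metric.ball u₀ 1 with hS
  have hSo : IsOpen S :=
    (isOpen_lt continuous_const g.continuous.norm).inter Metric.isOpen_ball
  have hSn : S.Nonempty := ⟨u₀, hc2, Metric.mem_ball_self one_pos⟩
  have hSfin : volume S ≠ ⊤ :=
    ((measure_mono Set.inter_subset_right).trans_lt measure_ball_lt_top).ne
  set F : Lp ℂ 2 (volume : Measure V) := indicatorConstLp 2 hSo.measurableSet hSfin 1 with hF
  have hF0 : 0 < ‖F‖ := by
    rw [hF, norm_indicatorConstLp (by norm_num) (by norm_num), norm_one, one_mul]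
    exact Real.rpow_pos_of_pos
      (ENNReal.toReal_pos (hSo.measure_pos volume hSn).ne' hSfin) _
  have h1 : ‖F‖ ≤ c⁻¹ * ‖mulOp g F‖ := by
    refine Lp.norm_le_mul_norm_of_ae_le_mul ?_
    filter_upwards [coeFn_mulOp g F,
      indicatorConstLp_coeFn (p := 2) (hs := hSo.measurableSet) (hμs := hSfin) (c := (1 : ℂ))]
      with u hu hu'
    rw [hu, norm_mul, hF, hu']
    by_cases hmem : u ∈ S
    · rw [Set.indicator_of_mem hmem, norm_one, mul_one, ← div_eq_inv_mul, one_le_div hc0]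
      exact hmem.1.le
    · simp [Set.indicator_of_notMem hmem]
  have h2 : c⁻¹ * ‖mulOp g F‖ < ‖F‖ := by
    rw [← div_eq_inv_mul, div_lt_iff₀ hc0, mul_comm]
    exact ((mulOp g).le_opNorm F).trans_lt (mul_lt_mul_of_pos_right hc1 hF0)
  exact absurd h1 (not_le.2 h2)

/-- On `L¹ ∩ L²` the `L²` Fourier transform is given by the Fourier integral. -/
theorem fourier_toLp_ae_eq {k : V → ℂ} (hk : Integrable k) (hk2 : MemLp k 2) :
    ((𝓕 hk2.toLp : Lp ℂ 2 (volume : Measure V)) : V → ℂ) =ᵐ[volume] 𝓕 k := by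
  have hcont : Continuous (𝓕 k) :=
    VectorFourier.fourierIntegral_continuous Real.continuous_fourierChar continuous_inner hk
  refine ae_eq_of_integral_contDiff_smul_eq
    ((Lp.memLp _).locallyIntegrable (by norm_num)) hcont.locallyIntegrable fun g hg hgc => ?_
  have hgc' : HasCompactSupport (fun x => (g x : ℂ)) := hgc.comp_left Complex.ofReal_zero
  set G : 𝓢(V, ℂ) := hgc'.toSchwartzMap (Complex.ofRealCLM.contDiff.comp hg) with hG
  have hGv : ∀ x, G x = (g x : ℂ) := fun x => rfl
  have h1 := congrArg (fun T => T G) (Lp.fourier_toTemperedDistribution_eq hk2.toLp)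
  simp only [TemperedDistribution.fourier_apply, Lp.toTemperedDistribution_apply] at h1
  have h2 := VectorFourier.integral_fourierIntegral_smul_eq_flip (μ := volume) (ν := volume)
    (L := innerₗ V) (e := Real.fourierChar) (f := (G : V → ℂ)) (g := k)
    Real.continuous_fourierChar continuous_inner G.integrable hk
  calc ∫ x, g x • (𝓕 hk2.toLp : Lp ℂ 2 (volume : Measure V)) x
      = ∫ x, G x • (𝓕 hk2.toLp : Lp ℂ 2 (volume : Measure V)) x := by
        refine integral_congr_ae (Eventually.of_forall fun x => ?_)
        simp [hGv]
    _ = ∫ x, (𝓕 G : 𝓢(V, ℂ)) x • (hk2.toLp : Lp ℂ 2 (volume : Measure V)) x := h1.symm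
    _ = ∫ x, (𝓕 (G : V → ℂ)) x • k x := by
        refine integral_congr_ae ?_
        filter_upwards [hk2.coeFn_toLp] with x hx
        rw [hx, SchwartzMap.fourier_coe]
    _ = ∫ x, G x • 𝓕 k x := by
        refine h2.trans (integral_congr_ae (Eventually.of_forall fun x => ?_))
        simp only [VectorFourier.fourierIntegral, LinearMap.flip_apply, Real.fourier_eq,
          innerₗ_apply_apply, real_inner_comm]
    _ = ∫ x, g x • 𝓕 k x := by
        refine integral_congr_ae (Eventually.of_forall fun x => ?_)
        simp [hGv]

/-- Plancherel's theorem for the Fourier integral on `L¹ ∩ L²`. -/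
theorem lintegral_enorm_fourier_sq {k : V → ℂ} (hk : Integrable k) (hk2 : MemLp k 2) :
    ∫⁻ a, ‖𝓕 k a‖ₑ ^ 2 = ∫⁻ s, ‖k s‖ₑ ^ 2 := by
  have h1 : ∫⁻ a, ‖𝓕 k a‖ₑ ^ 2
      = ∫⁻ a, ‖(𝓕 hk2.toLp : Lp ℂ 2 (volume : Measure V)) a‖ₑ ^ 2 :=
    lintegral_congr_ae ((fourier_toLp_ae_eq hk hk2).mono fun a ha => by simp only [ha])
  have h2 : ∫⁻ s, ‖k s‖ₑ ^ 2 = ∫⁻ s, ‖(hk2.toLp : Lp ℂ 2 (volume : Measure V)) s‖ₑ ^ 2 :=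
    lintegral_congr_ae (hk2.coeFn_toLp.mono fun a ha => by simp only [ha])
  rw [h1, h2, lintegral_enorm_sq, lintegral_enorm_sq, Lp.norm_fourier_eq]

-- Unfolding this operator in unification problems is costly; its behaviour is recorded above.
attribute [irreducible] mulOp

end Mul

/-! ### Time-frequency shifts and the orthogonality relations -/

section TimeFrequency

variable {V : Type*} [NormedAddCommGroup V] [InnerProductSpace ℝ V] [FiniteDimensional ℝ V]
  [MeasurableSpace V] [BorelSpace V]

/-- The time-frequency shift `ψ ↦ (s ↦ exp(2πi a·s) ψ(s + b))` of `L²`. -/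
def tfShift (a b : V) : Lp ℂ 2 (volume : Measure V) →ₗᵢ[ℂ] Lp ℂ 2 (volume : Measure V) where
  toLinearMap := (mulOp (planeWave a)).toLinearMap ∘ₗ
    (Lp.compMeasurePreservingₗᵢ ℂ (fun s => s + b)
      (measurePreserving_add_right volume b)).toLinearMap
  norm_map' ψ := (norm_mulOp_planeWave a _).trans (LinearIsometry.norm_map _ ψ)

theorem coeFn_tfShift (a b : V) (ψ : Lp ℂ 2 (volume : Measure V)) :
    tfShift a b ψ =ᵐ[volume] fun s => planeWave a s * ψ (s + b) := by
  filter_upwards [coeFn_mulOp (planeWave a) (Lp.compMeasurePreserving (fun s => s + b)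
    (measurePreserving_add_right volume b) ψ),
    Lp.coeFn_compMeasurePreserving ψ (measurePreserving_add_right volume b)] with s h1 h2
  refine h1.trans ?_
  rw [h2]
  rfl

theorem tfShift_zero (ψ : Lp ℂ 2 (volume : Measure V)) : tfShift 0 0 ψ = ψ := by
  refine Lp.ext ?_
  filter_upwards [coeFn_tfShift 0 0 ψ] with s hs
  rw [hs, planeWave_apply, inner_zero_left]
  simp

theorem tfShift_tfShift (a b c d : V) (ψ : Lp ℂ 2 (volume : Measure V)) :
    tfShift c d (tfShift a b ψ)
      = ((Real.fourierChar ⟪a, d⟫_ℝ : Circle) : ℂ) • tfShift (a + c) (b + d) ψ := by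
  refine Lp.ext ?_
  have h2 := (measurePreserving_add_right (volume : Measure V) d).quasiMeasurePreserving.ae
    (coeFn_tfShift a b ψ)
  filter_upwards [coeFn_tfShift c d (tfShift a b ψ), h2, coeFn_tfShift (a + c) (b + d) ψ,
    Lp.coeFn_smul ((Real.fourierChar ⟪a, d⟫_ℝ : Circle) : ℂ) (tfShift (a + c) (b + d) ψ)]
    with s h1 h2 h3 h4
  rw [h1, h2, h4, Pi.smul_apply, h3]
  simp only [planeWave_apply, inner_add_left, inner_add_right, AddChar.map_add_eq_mul,
    Circle.coe_mul, smul_eq_mul]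
  rw [show s + d + b = s + (b + d) by abel]
  ring

theorem tfShift_comm (a b c d : V) (ψ : Lp ℂ 2 (volume : Measure V)) :
    tfShift c d (tfShift a b ψ)
      = ((Real.fourierChar (⟪a, d⟫_ℝ - ⟪c, b⟫_ℝ) : Circle) : ℂ) •
        tfShift a b (tfShift c d ψ) := by
  rw [tfShift_tfShift, tfShift_tfShift, smul_smul, ← Circle.coe_mul, ← AddChar.map_add_eq_mul,
    sub_add_cancel, add_comm c a, add_comm d b]

theorem continuous_tfShift (ψ : Lp ℂ 2 (volume : Measure V)) :
    Continuous fun p : V × V => tfShift p.1 p.2 ψ := by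
  have hshift : Continuous fun b : V => Lp.compMeasurePreserving (fun s => s + b)
      (measurePreserving_add_right volume b) ψ := by
    let g : C(V, C(V, V)) :=
      (ContinuousMap.mk (fun p : V × V => p.2 + p.1) (continuous_snd.add continuous_fst)).curry
    exact (continuous_const (y := ψ)).compMeasurePreservingLp g.continuous
      (fun b => measurePreserving_add_right volume b) (by norm_num)
  refine continuous_iff_continuousAt.2 fun p => ?_
  set φ : V → Lp ℂ 2 (volume : Measure V) := fun b => Lp.compMeasurePreserving (fun s => s + b)
      (measurePreserving_add_right volume b) ψ with hφ
  have h1 : Tendsto (fun q : V × V => ‖φ q.2 - φ p.2‖ +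
      ‖mulOp (planeWave q.1) (φ p.2) - mulOp (planeWave p.1) (φ p.2)‖) (𝓝 p) (𝓝 0) := by
    have hc : Continuous (fun q : V × V => ‖φ q.2 - φ p.2‖ +
      ‖mulOp (planeWave q.1) (φ p.2) - mulOp (planeWave p.1) (φ p.2)‖) :=
      ((hshift.comp continuous_snd).sub continuous_const).norm.add
        (((continuous_mulOp_planeWave (φ p.2)).comp continuous_fst).sub continuous_const).norm
    have := hc.tendsto p
    simpa using this
  refine tendsto_iff_norm_sub_tendsto_zero.2
    (squeeze_zero (fun _ => norm_nonneg _) (fun q => ?_) h1)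
  have h2 : tfShift q.1 q.2 ψ - tfShift p.1 p.2 ψ
      = mulOp (planeWave q.1) (φ q.2 - φ p.2) +
        (mulOp (planeWave q.1) (φ p.2) - mulOp (planeWave p.1) (φ p.2)) := by
    rw [map_sub, sub_add_sub_cancel]
    rfl
  rw [h2]
  refine (norm_add_le _ _).trans ?_
  rw [norm_mulOp_planeWave]

theorem inner_tfShift_left (a b : V) (φ ξ : Lp ℂ 2 (volume : Measure V)) :
    ⟪tfShift a b φ, ξ⟫_ℂ = 𝓕 (fun s => ξ s * (starRingEnd ℂ) (φ (s + b))) a := by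
  rw [L2.inner_def, Real.fourier_eq]
  refine integral_congr_ae ?_
  filter_upwards [coeFn_tfShift a b φ] with s hs
  rw [hs, RCLike.inner_apply, map_mul, planeWave_apply, Circle.smul_def, smul_eq_mul,
    AddChar.map_neg_eq_inv, Circle.coe_inv_eq_conj, real_inner_comm]
  ring

theorem memLp_comp_add (φ : Lp ℂ 2 (volume : Measure V)) (b : V) :
    MemLp (fun s => φ (s + b)) 2 :=
  (Lp.memLp φ).comp_measurePreserving (measurePreserving_add_right volume b)

theorem integrable_mul_conj_comp_add (φ ξ : Lp ℂ 2 (volume : Measure V)) (b : V) :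
    Integrable fun s => ξ s * (starRingEnd ℂ) (φ (s + b)) := by
  have := (memLp_comp_add φ b).star
  exact (Lp.memLp ξ).integrable_mul this

theorem lintegral_comp_add_smul (φ : Lp ℂ 2 (volume : Measure V)) {c : ℝ} (hc : c ≠ 0) (s : V) :
    ∫⁻ b, ‖φ (s + c • b)‖ₑ ^ 2 = ENNReal.ofReal ((|c| ^ Module.finrank ℝ V)⁻¹ * ‖φ‖ ^ 2) := by
  have hm : Measurable fun t : V => ‖φ t‖ₑ ^ 2 :=
    (Lp.stronglyMeasurable φ).enorm.pow_const 2
  have h1 := lintegral_map (μ := (volume : Measure V)) (f := fun t : V => ‖φ (s + t)‖ₑ ^ 2)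
    (g := fun b => c • b) (hm.comp (measurable_const_add s)) (measurable_const_smul c)
  rw [Measure.map_addHaar_smul _ hc, lintegral_smul_measure,
    lintegral_add_left_eq_self (fun t : V => ‖φ t‖ₑ ^ 2) s, lintegral_enorm_sq] at h1
  rw [← h1, smul_eq_mul, ← ENNReal.ofReal_mul (abs_nonneg _), abs_inv, abs_pow]

/-- The orthogonality relations for the matrix coefficients of the time-frequency shifts, with the
time variable rescaled by `c`: by Plancherel in `a`, and then Tonelli. -/
theorem lintegral_inner_tfShift (φ ξ : Lp ℂ 2 (volume : Measure V)) {c : ℝ} (hc : c ≠ 0) :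
    ∫⁻ p : V × V, ‖⟪tfShift p.1 (c • p.2) φ, ξ⟫_ℂ‖ₑ ^ 2 ∂(volume.prod volume)
      = ENNReal.ofReal ((|c| ^ Module.finrank ℝ V)⁻¹ * (‖φ‖ * ‖ξ‖) ^ 2) := by
  have hcont : Continuous fun p : V × V => ⟪tfShift p.1 (c • p.2) φ, ξ⟫_ℂ :=
    ((continuous_tfShift φ).comp (continuous_fst.prodMk (continuous_snd.const_smul c))).inner
      continuous_const
  have hmeas : Measurable fun p : V × V =>
      ‖ξ p.2 * (starRingEnd ℂ) (φ (p.2 + c • p.1))‖ₑ ^ 2 := by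
    have h1 : Measurable fun p : V × V => ξ p.2 :=
      (Lp.stronglyMeasurable ξ).measurable.comp measurable_snd
    have h2 : Measurable fun p : V × V => φ (p.2 + c • p.1) :=
      (Lp.stronglyMeasurable φ).measurable.comp
        (measurable_snd.add (measurable_fst.const_smul c))
    exact (h1.mul (RCLike.continuous_conj.measurable.comp h2)).enorm.pow_const 2
  have htotal : ∫⁻ b : V, ∫⁻ s : V, ‖ξ s * (starRingEnd ℂ) (φ (s + c • b))‖ₑ ^ 2
      = ENNReal.ofReal ((|c| ^ Module.finrank ℝ V)⁻¹ * (‖φ‖ * ‖ξ‖) ^ 2) := by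
    rw [lintegral_lintegral_swap hmeas.aemeasurable]
    have h1 : ∀ s : V, ∫⁻ b : V, ‖ξ s * (starRingEnd ℂ) (φ (s + c • b))‖ₑ ^ 2
        = ‖ξ s‖ₑ ^ 2 * ENNReal.ofReal ((|c| ^ Module.finrank ℝ V)⁻¹ * ‖φ‖ ^ 2) := fun s => by
      rw [← lintegral_comp_add_smul φ hc s, ← lintegral_const_mul']
      · simp only [enorm_mul, mul_pow, RCLike.enorm_conj]
      · exact ENNReal.pow_ne_top enorm_ne_top
    simp only [h1]
    rw [lintegral_mul_const' _ _ ENNReal.ofReal_ne_top, lintegral_enorm_sq,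
      ← ENNReal.ofReal_mul (by positivity)]
    congr 1
    ring
  have hae : ∀ᵐ b : V, ∫⁻ s : V, ‖ξ s * (starRingEnd ℂ) (φ (s + c • b))‖ₑ ^ 2 < ⊤ :=
    ae_lt_top hmeas.lintegral_prod_right' (by rw [htotal]; exact ENNReal.ofReal_ne_top)
  rw [lintegral_prod_symm' _ (hcont.enorm.measurable.pow_const 2), ← htotal]
  refine lintegral_congr_ae ?_
  filter_upwards [hae] with b hb
  simp only [inner_tfShift_left]
  refine lintegral_enorm_fourier_sq (integrable_mul_conj_comp_add φ ξ (c • b)) ?_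
  rw [memLp_two_iff_integrable_sq_norm (integrable_mul_conj_comp_add φ ξ (c • b)).1]
  refine ⟨(integrable_mul_conj_comp_add φ ξ (c • b)).1.norm.pow 2, ?_⟩
  rw [hasFiniteIntegral_iff_enorm]
  simpa only [enorm_pow, enorm_norm] using hb

/-! ### The coherent state transform -/

/-- The function `u = (a, b) ↦ |λ|^{-d/2} ⟨ρ_λ(u) φ, ξ⟩`, where `ρ_λ(a, b)` is the time-frequency
shift by `(a, b/λ)` and `d` is the dimension. -/
def coherentFun (l : Rstar) (φ ξ : Lp ℂ 2 (volume : Measure V)) (u : WithLp 2 (V × V)) : ℂ :=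
  (√((|l.1| ^ Module.finrank ℝ V)⁻¹) : ℝ) * ⟪tfShift u.fst (l.1⁻¹ • u.snd) φ, ξ⟫_ℂ

theorem continuous_coherentFun (l : Rstar) (φ ξ : Lp ℂ 2 (volume : Measure V)) :
    Continuous (coherentFun l φ ξ) := by
  refine continuous_const.mul (Continuous.inner ?_ continuous_const)
  exact (continuous_tfShift φ).comp (((WithLp.prod_continuous_ofLp 2 V V).fst).prodMk
    ((WithLp.prod_continuous_ofLp 2 V V).snd.const_smul l.1⁻¹))

theorem lintegral_coherentFun (l : Rstar) (φ ξ : Lp ℂ 2 (volume : Measure V)) :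
    ∫⁻ u, ‖coherentFun l φ ξ u‖ₑ ^ 2 = ENNReal.ofReal ((‖φ‖ * ‖ξ‖) ^ 2) := by
  have hl : 0 < |l.1| ^ Module.finrank ℝ V := pow_pos (abs_pos.2 l.2) _
  have hcont : Continuous fun p : V × V => ⟪tfShift p.1 (l.1⁻¹ • p.2) φ, ξ⟫_ℂ :=
    ((continuous_tfShift φ).comp (continuous_fst.prodMk (continuous_snd.const_smul _))).inner
      continuous_const
  have h1 := (WithLp.volume_preserving_ofLp V V).lintegral_comp
    (f := fun p : V × V => ‖⟪tfShift p.1 (l.1⁻¹ • p.2) φ, ξ⟫_ℂ‖ₑ ^ 2)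
    (hcont.enorm.measurable.pow_const 2)
  have h2 := lintegral_inner_tfShift φ ξ (inv_ne_zero l.2)
  rw [← Measure.volume_eq_prod, ← h1] at h2
  have h3 : ∀ u : WithLp 2 (V × V), ‖coherentFun l φ ξ u‖ₑ ^ 2
      = ENNReal.ofReal ((|l.1| ^ Module.finrank ℝ V)⁻¹) *
        ‖⟪tfShift u.fst (l.1⁻¹ • u.snd) φ, ξ⟫_ℂ‖ₑ ^ 2 := fun u => by
    rw [coherentFun, enorm_mul, mul_pow]
    congr 1
    rw [← ofReal_norm, ← ENNReal.ofReal_pow (norm_nonneg _), Complex.norm_real, Real.norm_eq_abs,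
      sq_abs, Real.sq_sqrt (inv_nonneg.2 hl.le)]
  simp only [h3]
  rw [lintegral_const_mul' _ _ ENNReal.ofReal_ne_top]
  refine (congrArg _ h2).trans ?_
  rw [← ENNReal.ofReal_mul (inv_nonneg.2 hl.le), abs_inv, inv_pow, inv_inv, ← mul_assoc,
    inv_mul_cancel₀ hl.ne', one_mul]

theorem memLp_coherentFun (l : Rstar) (φ ξ : Lp ℂ 2 (volume : Measure V)) :
    MemLp (coherentFun l φ ξ) 2 := by
  rw [memLp_two_iff_integrable_sq_norm (continuous_coherentFun l φ ξ).aestronglyMeasurable]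
  refine ⟨(continuous_coherentFun l φ ξ).norm.pow 2 |>.aestronglyMeasurable, ?_⟩
  rw [hasFiniteIntegral_iff_enorm]
  simp only [enorm_pow, enorm_norm]
  rw [lintegral_coherentFun]
  exact ENNReal.ofReal_lt_top

theorem norm_toLp_coherentFun (l : Rstar) (φ ξ : Lp ℂ 2 (volume : Measure V)) :
    ‖(memLp_coherentFun l φ ξ).toLp‖ = ‖φ‖ * ‖ξ‖ := by
  have h := lintegral_enorm_sq (memLp_coherentFun l φ ξ).toLp
  have h1 : ∫⁻ u, ‖((memLp_coherentFun l φ ξ).toLp :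
      Lp ℂ 2 (volume : Measure (WithLp 2 (V × V)))) u‖ₑ ^ 2 = ∫⁻ u, ‖coherentFun l φ ξ u‖ₑ ^ 2 :=
    lintegral_congr_ae ((memLp_coherentFun l φ ξ).coeFn_toLp.mono fun u hu => by simp only [hu])
  rw [h1, lintegral_coherentFun,
    ENNReal.ofReal_eq_ofReal_iff (by positivity) (by positivity)] at h
  exact ((pow_left_inj₀ (by positivity) (norm_nonneg _) two_ne_zero).1 h).symm

/-- The coherent state transform `ξ ↦ (u ↦ |λ|^{-d/2} ⟨ρ_λ(u) φ, ξ⟩)` with window `φ`, an isometry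
if `‖φ‖ = 1`. -/
def coherentOp (l : Rstar) (φ : Lp ℂ 2 (volume : Measure V)) :
    Lp ℂ 2 (volume : Measure V) →L[ℂ] Lp ℂ 2 (volume : Measure (WithLp 2 (V × V))) :=
  LinearMap.mkContinuous
    { toFun := fun ξ => (memLp_coherentFun l φ ξ).toLp
      map_add' := fun ξ ζ => by
        rw [← MemLp.toLp_add]
        refine MemLp.toLp_congr _ _ (Eventually.of_forall fun u => ?_)
        simp only [coherentFun, inner_add_right, mul_add, Pi.add_apply]
      map_smul' := fun c ξ => by
        rw [RingHom.id_apply, ← MemLp.toLp_const_smul]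
        refine MemLp.toLp_congr _ _ (Eventually.of_forall fun u => ?_)
        simp only [coherentFun, inner_smul_right, Pi.smul_apply, smul_eq_mul]
        ring }
    ‖φ‖ fun ξ => (norm_toLp_coherentFun l φ ξ).le

theorem coeFn_coherentOp (l : Rstar) (φ ξ : Lp ℂ 2 (volume : Measure V)) :
    coherentOp l φ ξ =ᵐ[volume] coherentFun l φ ξ :=
  (memLp_coherentFun l φ ξ).coeFn_toLp

theorem norm_coherentOp_apply (l : Rstar) (φ ξ : Lp ℂ 2 (volume : Measure V)) :
    ‖coherentOp l φ ξ‖ = ‖φ‖ * ‖ξ‖ :=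
  norm_toLp_coherentFun l φ ξ

theorem coherentOp_sub (l : Rstar) (φ ψ ξ : Lp ℂ 2 (volume : Measure V)) :
    coherentOp l (φ - ψ) ξ = coherentOp l φ ξ - coherentOp l ψ ξ := by
  refine Lp.ext ?_
  filter_upwards [coeFn_coherentOp l (φ - ψ) ξ, coeFn_coherentOp l φ ξ, coeFn_coherentOp l ψ ξ,
    Lp.coeFn_sub (coherentOp l φ ξ) (coherentOp l ψ ξ)] with u h1 h2 h3 h4
  rw [h1, h4, Pi.sub_apply, h2, h3]
  simp only [coherentFun, map_sub, inner_sub_left, mul_sub]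

/-- The time-frequency shift `σ_v` whose conjugation action on `ρ_λ(u)` is multiplication by the
plane wave `exp(2πi v·u)`. -/
def dualShift (l : Rstar) (v : WithLp 2 (V × V)) :
    Lp ℂ 2 (volume : Measure V) →ₗᵢ[ℂ] Lp ℂ 2 (volume : Measure V) :=
  tfShift (-(l.1 • v.snd)) v.fst

theorem dualShift_tfShift (l : Rstar) (v u : WithLp 2 (V × V))
    (ψ : Lp ℂ 2 (volume : Measure V)) :
    dualShift l v (tfShift u.fst (l.1⁻¹ • u.snd) ψ)
      = planeWave v u • tfShift u.fst (l.1⁻¹ • u.snd) (dualShift l v ψ) := by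
  rw [dualShift, tfShift_comm, planeWave_apply, WithLp.prod_inner_apply]
  congr 4
  rw [inner_neg_left, inner_smul_left, inner_smul_right, sub_neg_eq_add, real_inner_comm]
  congr 1
  simp [l.2]

/-- Multiplying a coherent state transform by a plane wave amounts to shifting both the window and
the function. -/
theorem mulOp_planeWave_coherentOp (l : Rstar) (v : WithLp 2 (V × V))
    (φ ξ : Lp ℂ 2 (volume : Measure V)) :
    mulOp (planeWave v) (coherentOp l φ ξ)
      = coherentOp l (dualShift l v φ) (dualShift l v ξ) := by
  refine Lp.ext ?_
  filter_upwards [coeFn_mulOp (planeWave v) (coherentOp l φ ξ), coeFn_coherentOp l φ ξ,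
    coeFn_coherentOp l (dualShift l v φ) (dualShift l v ξ)] with u h1 h2 h3
  rw [h1, h2, h3]
  simp only [coherentFun]
  rw [← (dualShift l v).inner_map_map (tfShift u.fst (l.1⁻¹ • u.snd) φ) ξ, dualShift_tfShift,
    inner_smul_left]
  have h4 : planeWave v u * (starRingEnd ℂ) (planeWave v u) = 1 := by
    rw [RCLike.mul_conj, norm_planeWave_apply]
    simp
  linear_combination ((√((|l.1| ^ Module.finrank ℝ V)⁻¹) : ℝ) : ℂ) *
    ⟪tfShift u.fst (l.1⁻¹ • u.snd) (dualShift l v φ), dualShift l v ξ⟫_ℂ * h4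

theorem norm_mulOp_planeWave_coherentOp_sub (l : Rstar) (v : WithLp 2 (V × V))
    (φ ξ : Lp ℂ 2 (volume : Measure V)) :
    ‖mulOp (planeWave v) (coherentOp l φ ξ) - coherentOp l φ (dualShift l v ξ)‖
      = ‖dualShift l v φ - φ‖ * ‖ξ‖ := by
  rw [mulOp_planeWave_coherentOp, ← coherentOp_sub, norm_coherentOp_apply,
    LinearIsometry.norm_map]

attribute [irreducible] tfShift coherentOp

end TimeFrequency

/-! ### Toeplitz operators and their semiclassical behaviour -/

section Toeplitz

variable {V : Type*} [NormedAddCommGroup V] [InnerProductSpace ℝ V] [FiniteDimensional ℝ V]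
  [MeasurableSpace V] [BorelSpace V]

theorem norm_coherentOp_le (l : Rstar) (φ : Lp ℂ 2 (volume : Measure V)) :
    ‖coherentOp l φ‖ ≤ ‖φ‖ :=
  ContinuousLinearMap.opNorm_le_bound _ (norm_nonneg _) fun ξ => (norm_coherentOp_apply l φ ξ).le

theorem adjoint_coherentOp_coherentOp (l : Rstar) {φ : Lp ℂ 2 (volume : Measure V)}
    (hφ : ‖φ‖ = 1) (ξ : Lp ℂ 2 (volume : Measure V)) :
    (coherentOp l φ).adjoint (coherentOp l φ ξ) = ξ := by
  have h := (ContinuousLinearMap.norm_map_iff_adjoint_comp_self (coherentOp l φ)).1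
    fun ξ => by rw [norm_coherentOp_apply, hφ, one_mul]
  exact DFunLike.congr_fun h ξ

theorem norm_adjoint_coherentOp_apply_le (l : Rstar) {φ : Lp ℂ 2 (volume : Measure V)}
    (hφ : ‖φ‖ = 1) (x : Lp ℂ 2 (volume : Measure (WithLp 2 (V × V)))) :
    ‖(coherentOp l φ).adjoint x‖ ≤ ‖x‖ := by
  have h : ‖(coherentOp l φ).adjoint‖ ≤ 1 := by
    rw [LinearIsometryEquiv.norm_map]
    exact hφ ▸ norm_coherentOp_le l φ
  simpa using (coherentOp l φ).adjoint.le_of_opNorm_le h x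

theorem norm_sub_coherentOp_adjoint_le (l : Rstar) {φ : Lp ℂ 2 (volume : Measure V)}
    (hφ : ‖φ‖ = 1) (x : Lp ℂ 2 (volume : Measure (WithLp 2 (V × V)))) :
    ‖x - coherentOp l φ ((coherentOp l φ).adjoint x)‖ ≤ 2 * ‖x‖ := by
  have h1 : ‖coherentOp l φ ((coherentOp l φ).adjoint x)‖ ≤ ‖x‖ := by
    rw [norm_coherentOp_apply, hφ, one_mul]
    exact norm_adjoint_coherentOp_apply_le l hφ x
  have h2 := norm_sub_le x (coherentOp l φ ((coherentOp l φ).adjoint x))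
  linarith

/-- The Toeplitz operator `W⋆ M_g W` with symbol `g`, where `W` is the coherent state transform with
window `φ`. -/
def toeplitz (l : Rstar) (φ : Lp ℂ 2 (volume : Measure V)) (g : WithLp 2 (V × V) →ᵇ ℂ) :
    Lp ℂ 2 (volume : Measure V) →L[ℂ] Lp ℂ 2 (volume : Measure V) :=
  (coherentOp l φ).adjoint ∘L mulOp g ∘L coherentOp l φ

theorem inner_toeplitz (l : Rstar) (φ : Lp ℂ 2 (volume : Measure V))
    (g : WithLp 2 (V × V) →ᵇ ℂ) (ζ ξ : Lp ℂ 2 (volume : Measure V)) :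
    ⟪ζ, toeplitz l φ g ξ⟫_ℂ = ⟪coherentOp l φ ζ, mulOp g (coherentOp l φ ξ)⟫_ℂ := by
  simp only [toeplitz, ContinuousLinearMap.comp_apply, ContinuousLinearMap.adjoint_inner_right]

theorem toeplitz_apply (l : Rstar) (φ : Lp ℂ 2 (volume : Measure V))
    (g : WithLp 2 (V × V) →ᵇ ℂ) (ξ : Lp ℂ 2 (volume : Measure V)) :
    toeplitz l φ g ξ = (coherentOp l φ).adjoint (mulOp g (coherentOp l φ ξ)) := by
  simp only [toeplitz, ContinuousLinearMap.comp_apply]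

theorem toeplitz_add (l : Rstar) (φ : Lp ℂ 2 (volume : Measure V))
    (g g' : WithLp 2 (V × V) →ᵇ ℂ) :
    toeplitz l φ (g + g') = toeplitz l φ g + toeplitz l φ g' := by
  ext1 ξ
  simp only [toeplitz, map_add, ContinuousLinearMap.comp_apply, add_apply]

theorem toeplitz_smul (l : Rstar) (φ : Lp ℂ 2 (volume : Measure V)) (c : ℂ)
    (g : WithLp 2 (V × V) →ᵇ ℂ) :
    toeplitz l φ (c • g) = c • toeplitz l φ g := by
  ext1 ξ
  simp only [toeplitz, map_smul, ContinuousLinearMap.comp_apply, smul_apply]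

theorem star_toeplitz (l : Rstar) (φ : Lp ℂ 2 (volume : Measure V))
    (g : WithLp 2 (V × V) →ᵇ ℂ) :
    star (toeplitz l φ g) = toeplitz l φ (star g) := by
  rw [ContinuousLinearMap.star_eq_adjoint]
  refine ((ContinuousLinearMap.eq_adjoint_iff _ _).2 fun ξ ζ => ?_).symm
  rw [inner_toeplitz, ← inner_conj_symm, inner_toeplitz, inner_mulOp_star, inner_conj_symm]

theorem norm_toeplitz_le (l : Rstar) {φ : Lp ℂ 2 (volume : Measure V)} (hφ : ‖φ‖ = 1)
    (g : WithLp 2 (V × V) →ᵇ ℂ) : ‖toeplitz l φ g‖ ≤ ‖g‖ := by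
  have hW : ‖coherentOp l φ‖ ≤ 1 := hφ ▸ norm_coherentOp_le l φ
  have hW' : ‖(coherentOp l φ).adjoint‖ ≤ 1 := by rwa [LinearIsometryEquiv.norm_map]
  calc ‖toeplitz l φ g‖
      ≤ ‖(coherentOp l φ).adjoint‖ * (‖mulOp g‖ * ‖coherentOp l φ‖) :=
        (ContinuousLinearMap.opNorm_comp_le _ _).trans
          (mul_le_mul_of_nonneg_left (ContinuousLinearMap.opNorm_comp_le _ _) (norm_nonneg _))
    _ ≤ 1 * (‖g‖ * 1) := by
        gcongr
        exact norm_mulOp_le g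
    _ = ‖g‖ := by ring

/-- The total defect `∫ |f(v)| · 2 ‖σ_{-v} φ - φ‖ dv`, which controls all the error terms of the
Toeplitz quantization of the symbol `f̂`. -/
def defect (l : Rstar) (φ : Lp ℂ 2 (volume : Measure V)) (f : WithLp 2 (V × V) → ℂ) : ℝ :=
  ∫ v, ‖f v‖ * (2 * ‖dualShift l (-v) φ - φ‖)

theorem continuous_dualShift (l : Rstar) (φ : Lp ℂ 2 (volume : Measure V)) :
    Continuous fun v : WithLp 2 (V × V) => dualShift l v φ := by
  unfold dualShift
  exact (continuous_tfShift φ).comp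
    (((WithLp.prod_continuous_ofLp 2 V V).snd.const_smul l.1).neg.prodMk
      (WithLp.prod_continuous_ofLp 2 V V).fst)

theorem norm_dualShift_sub_le (l : Rstar) (v : WithLp 2 (V × V))
    (φ : Lp ℂ 2 (volume : Measure V)) : ‖dualShift l v φ - φ‖ ≤ 2 * ‖φ‖ := by
  refine (norm_sub_le _ _).trans ?_
  rw [LinearIsometry.norm_map]
  linarith

theorem aestronglyMeasurable_defect (l : Rstar) (φ : Lp ℂ 2 (volume : Measure V))
    {f : WithLp 2 (V × V) → ℂ} (hf : Integrable f) :
    AEStronglyMeasurable (fun v => ‖f v‖ * (2 * ‖dualShift l (-v) φ - φ‖)) volume :=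
  hf.1.norm.mul (((((continuous_dualShift l φ).comp continuous_neg).sub
    continuous_const).norm.const_mul 2).aestronglyMeasurable)

theorem norm_defect_integrand_le (l : Rstar) (φ : Lp ℂ 2 (volume : Measure V))
    (f : WithLp 2 (V × V) → ℂ) (v : WithLp 2 (V × V)) :
    ‖‖f v‖ * (2 * ‖dualShift l (-v) φ - φ‖)‖ ≤ ‖f v‖ * (2 * (2 * ‖φ‖)) := by
  rw [norm_mul, norm_norm, norm_mul, norm_norm, Real.norm_two]
  gcongr
  exact norm_dualShift_sub_le l (-v) φ

theorem integrable_defect (l : Rstar) (φ : Lp ℂ 2 (volume : Measure V))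
    {f : WithLp 2 (V × V) → ℂ} (hf : Integrable f) :
    Integrable fun v => ‖f v‖ * (2 * ‖dualShift l (-v) φ - φ‖) :=
  (hf.norm.mul_const _).mono' (aestronglyMeasurable_defect l φ hf)
    (Eventually.of_forall (norm_defect_integrand_le l φ f))

instance : nearZero.IsCountablyGenerated := by unfold nearZero; infer_instance

theorem tendsto_defect {φ : Rstar → Lp ℂ 2 (volume : Measure V)} (hφ : ∀ l, ‖φ l‖ = 1)
    (hlim : ∀ v, Tendsto (fun l => ‖dualShift l v (φ l) - φ l‖) nearZero (𝓝 0))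
    {f : WithLp 2 (V × V) → ℂ} (hf : Integrable f) :
    Tendsto (fun l => defect l (φ l) f) nearZero (𝓝 0) := by
  have h := tendsto_integral_filter_of_dominated_convergence
    (F := fun l v => ‖f v‖ * (2 * ‖dualShift l (-v) (φ l) - φ l‖)) (f := fun _ => (0 : ℝ))
    (l := nearZero) (μ := (volume : Measure (WithLp 2 (V × V))))
    (fun v => ‖f v‖ * (2 * (2 * 1)))
    (Eventually.of_forall fun l => aestronglyMeasurable_defect l (φ l) hf)
    (Eventually.of_forall fun l => Eventually.of_forall fun v =>
      (norm_defect_integrand_le l (φ l) f v).trans (by rw [hφ l]))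
    (hf.norm.mul_const _)
    (Eventually.of_forall fun v => by simpa using ((hlim (-v)).const_mul 2).const_mul ‖f v‖)
  simpa [defect] using h

set_option maxHeartbeats 1000000 in
/-- `M_g W` almost maps into the range of `W`, if `g = f̂`: write `g` as a superposition of plane
waves, for each of which `M W ξ` is close to `W σ ξ`. -/
theorem norm_mulOp_coherentOp_sub_le (l : Rstar) {φ : Lp ℂ 2 (volume : Measure V)}
    (hφ : ‖φ‖ = 1) {f : WithLp 2 (V × V) → ℂ} (hf : Integrable f) {g : WithLp 2 (V × V) →ᵇ ℂ}
    (hg : ∀ u, g u = 𝓕 f u) (ξ : Lp ℂ 2 (volume : Measure V)) :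
    ‖mulOp g (coherentOp l φ ξ) - coherentOp l φ (toeplitz l φ g ξ)‖ ≤ defect l φ f * ‖ξ‖ := by
  -- `R = 1 - W W⋆` is the projection onto the orthogonal complement of the range of `W`
  set R : Lp ℂ 2 (volume : Measure (WithLp 2 (V × V))) →L[ℂ]
      Lp ℂ 2 (volume : Measure (WithLp 2 (V × V))) :=
    ContinuousLinearMap.id ℂ _ - coherentOp l φ ∘L (coherentOp l φ).adjoint with hR
  have hRx : ∀ x, R x = x - coherentOp l φ ((coherentOp l φ).adjoint x) := fun x => by
    simp only [hR, sub_apply, ContinuousLinearMap.comp_apply, ContinuousLinearMap.id_apply]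
  have hRW : ∀ ζ, R (coherentOp l φ ζ) = 0 := fun ζ => by
    rw [hRx, adjoint_coherentOp_coherentOp l hφ, sub_self]
  have hRn : ∀ x, ‖R x‖ ≤ 2 * ‖x‖ := fun x => by
    rw [hRx]
    exact norm_sub_coherentOp_adjoint_le l hφ x
  clear_value R
  have h1 : mulOp g (coherentOp l φ ξ) - coherentOp l φ (toeplitz l φ g ξ)
      = R (mulOp g (coherentOp l φ ξ)) := by
    rw [hRx, toeplitz_apply]
  have h2 : ∀ v, ‖R (mulOp (planeWave (-v)) (coherentOp l φ ξ))‖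
      ≤ (2 * ‖dualShift l (-v) φ - φ‖) * ‖ξ‖ := fun v => by
    have h3 : R (mulOp (planeWave (-v)) (coherentOp l φ ξ))
        = R (mulOp (planeWave (-v)) (coherentOp l φ ξ) - coherentOp l φ (dualShift l (-v) ξ)) := by
      have h4 := R.map_sub (mulOp (planeWave (-v)) (coherentOp l φ ξ))
        (coherentOp l φ (dualShift l (-v) ξ))
      rw [hRW (dualShift l (-v) ξ)] at h4
      exact (h4.trans (sub_zero _)).symm
    have h4 := hRn (mulOp (planeWave (-v)) (coherentOp l φ ξ) -
      coherentOp l φ (dualShift l (-v) ξ))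
    rwa [← h3, norm_mulOp_planeWave_coherentOp_sub l (-v) φ ξ, ← mul_assoc] at h4
  have h4 := (integrable_defect l φ hf).mul_const ‖ξ‖
  have h5 : defect l φ f * ‖ξ‖ = ∫ v, ‖f v‖ * ((2 * ‖dualShift l (-v) φ - φ‖) * ‖ξ‖) := by
    rw [defect, ← integral_mul_const]
    exact integral_congr_ae (Eventually.of_forall fun v => mul_assoc _ _ _)
  rw [h1, h5]
  exact norm_apply_mulOp_le hf hg _ R
    (h4.congr (Eventually.of_forall fun v => mul_assoc _ _ _)) h2

/-- Approximate multiplicativity of the Toeplitz quantization, if one of the symbols is a Fourier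
transform. -/
theorem norm_toeplitz_mul_sub_le (l : Rstar) {φ : Lp ℂ 2 (volume : Measure V)}
    (hφ : ‖φ‖ = 1) {f : WithLp 2 (V × V) → ℂ} (hf : Integrable f)
    (g' : WithLp 2 (V × V) →ᵇ ℂ) {g : WithLp 2 (V × V) →ᵇ ℂ} (hg : ∀ u, g u = 𝓕 f u) :
    ‖toeplitz l φ (g' * g) - toeplitz l φ g' ∘L toeplitz l φ g‖ ≤ ‖g'‖ * defect l φ f := by
  have hd : 0 ≤ defect l φ f := integral_nonneg fun v => by positivity
  refine ContinuousLinearMap.opNorm_le_bound _ (by positivity) fun ξ => ?_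
  have h1 : (toeplitz l φ (g' * g) - toeplitz l φ g' ∘L toeplitz l φ g) ξ
      = (coherentOp l φ).adjoint (mulOp g' (mulOp g (coherentOp l φ ξ) -
          coherentOp l φ (toeplitz l φ g ξ))) := by
    simp only [map_sub, sub_apply, ContinuousLinearMap.comp_apply, toeplitz_apply, mulOp_mul]
  rw [h1]
  calc _ ≤ ‖mulOp g' (mulOp g (coherentOp l φ ξ) - coherentOp l φ (toeplitz l φ g ξ))‖ :=
        norm_adjoint_coherentOp_apply_le l hφ _
    _ ≤ ‖g'‖ * (defect l φ f * ‖ξ‖) := by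
        refine (ContinuousLinearMap.le_of_opNorm_le _ (norm_mulOp_le g') _).trans ?_
        exact mul_le_mul_of_nonneg_left (norm_mulOp_coherentOp_sub_le l hφ hf hg ξ)
          (norm_nonneg _)
    _ = _ := by ring

set_option maxHeartbeats 1000000 in
/-- The shifted window `ρ_λ(u) φ` is an approximate eigenvector of the Toeplitz operator with symbol
`g = f̂`, with eigenvalue `g u`. -/
theorem norm_toeplitz_tfShift_sub_le (l : Rstar) {φ : Lp ℂ 2 (volume : Measure V)}
    (hφ : ‖φ‖ = 1) {f : WithLp 2 (V × V) → ℂ} (hf : Integrable f) {g : WithLp 2 (V × V) →ᵇ ℂ}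
    (hg : ∀ u, g u = 𝓕 f u) (u : WithLp 2 (V × V)) :
    ‖toeplitz l φ g (tfShift u.fst (l.1⁻¹ • u.snd) φ)
      - g u • tfShift u.fst (l.1⁻¹ • u.snd) φ‖ ≤ defect l φ f := by
  set ψ := tfShift u.fst (l.1⁻¹ • u.snd) φ with hψ
  have hψn : ‖ψ‖ = 1 := (LinearIsometry.norm_map _ _).trans hφ
  have h1 : toeplitz l φ g ψ - g u • ψ
      = (coherentOp l φ).adjoint (mulOp g (coherentOp l φ ψ) - g u • coherentOp l φ ψ) := by
    rw [map_sub, map_smul, adjoint_coherentOp_coherentOp l hφ, toeplitz_apply]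
  rw [h1]
  refine (norm_adjoint_coherentOp_apply_le l hφ _).trans ?_
  refine norm_mulOp_sub_smul_le hf hg _ u (integrable_defect l φ hf) fun v => ?_
  have h3 : mulOp (planeWave (-v)) (coherentOp l φ ψ) - planeWave (-v) u • coherentOp l φ ψ
      = (mulOp (planeWave (-v)) (coherentOp l φ ψ) - coherentOp l φ (dualShift l (-v) ψ))
        + planeWave (-v) u • coherentOp l φ
          (tfShift u.fst (l.1⁻¹ • u.snd) (dualShift l (-v) φ - φ)) := by
    have h4 : dualShift l (-v) ψ
        = planeWave (-v) u • tfShift u.fst (l.1⁻¹ • u.snd) (dualShift l (-v) φ) :=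
      dualShift_tfShift l (-v) u φ
    have h5 : coherentOp l φ (tfShift u.fst (l.1⁻¹ • u.snd) (dualShift l (-v) φ - φ))
        = coherentOp l φ (tfShift u.fst (l.1⁻¹ • u.snd) (dualShift l (-v) φ))
          - coherentOp l φ ψ := by
      rw [(tfShift u.fst (l.1⁻¹ • u.snd)).map_sub (dualShift l (-v) φ) φ]
      exact (coherentOp l φ).map_sub _ _
    rw [h4, h5, (coherentOp l φ).map_smul (planeWave (-v) u), smul_sub, sub_add_sub_cancel]
  have h4 : ‖coherentOp l φ (tfShift u.fst (l.1⁻¹ • u.snd) (dualShift l (-v) φ - φ))‖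
      = ‖dualShift l (-v) φ - φ‖ := by
    have h5 := norm_coherentOp_apply l φ (tfShift u.fst (l.1⁻¹ • u.snd) (dualShift l (-v) φ - φ))
    rwa [hφ, one_mul, (tfShift u.fst (l.1⁻¹ • u.snd)).norm_map] at h5
  have h5 := norm_mulOp_planeWave_coherentOp_sub l (-v) φ ψ
  rw [hψn, mul_one] at h5
  rw [h3, two_mul]
  refine (norm_add_le _ _).trans (add_le_add h5.le ?_)
  rw [norm_smul, norm_planeWave_apply (-v) u, one_mul, h4]

end Toeplitz

/-! ### The states `η(λ, a, b)` -/

section Eta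

variable {n : ℕ}

theorem coeFn_etaL2 (η : 𝓢(Rn n, ℂ)) (l : Rstar) (u : R2n n) :
    etaL2 η l u =ᵐ[volume] etaFun η l u.fst u.snd :=
  (memLp_etaFun η l u.fst u.snd).coeFn_toLp

theorem etaL2_eq_tfShift (η : 𝓢(Rn n, ℂ)) (l : Rstar) (u : R2n n) :
    etaL2 η l u = tfShift u.fst (l.1⁻¹ • u.snd) (etaL2 η l 0) := by
  refine Lp.ext ?_
  filter_upwards [coeFn_etaL2 η l u, coeFn_tfShift u.fst (l.1⁻¹ • u.snd) (etaL2 η l 0),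
    (measurePreserving_add_right (volume : Measure (Rn n))
      (l.1⁻¹ • u.snd)).quasiMeasurePreserving.ae (coeFn_etaL2 η l 0)] with s h1 h2 h3
  rw [h1, h2, h3]
  simp only [etaFun, planeWave_apply, Real.fourierChar_apply, WithLp.zero_fst, WithLp.zero_snd,
    inner_zero_left, Complex.ofReal_zero, mul_zero, Complex.exp_zero, mul_one, smul_zero, add_zero]
  rw [show (2 * Real.pi * Complex.I * (⟪u.fst, s⟫_ℝ : ℝ) : ℂ)
    = ((2 * Real.pi * ⟪u.fst, s⟫_ℝ : ℝ) : ℂ) * Complex.I by push_cast; ring]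
  ring

/-- The unitary dilation `f ↦ |λ|^{n/4} f(|λ|^{1/2} ·)` preserves the norm of `L²(ℝⁿ)`. -/
theorem norm_eq_of_dilation (l : Rstar) {F G : L2Rn n} {f : Rn n → ℂ} (hG : G =ᵐ[volume] f)
    (hF : F =ᵐ[volume] fun s => ((|l.1| ^ ((n : ℝ) / 4) : ℝ) : ℂ) * f (√|l.1| • s)) :
    ‖F‖ = ‖G‖ := by
  have hl : 0 < |l.1| := abs_pos.2 l.2
  have hs : 0 < √|l.1| := Real.sqrt_pos.2 hl
  have h : ‖F‖ ^ 2 = ‖G‖ ^ 2 := by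
    have h1 : ∫ s, ‖F s‖ ^ 2 = ∫ s, (|l.1| ^ ((n : ℝ) / 4)) ^ 2 * ‖f (√|l.1| • s)‖ ^ 2 := by
      refine integral_congr_ae ?_
      filter_upwards [hF] with s hs'
      rw [hs', norm_mul, mul_pow, Complex.norm_real, Real.norm_eq_abs, sq_abs]
    have h2 : ∫ s, ‖G s‖ ^ 2 = ∫ s, ‖f s‖ ^ 2 :=
      integral_congr_ae (hG.mono fun s hs' => by simp only [hs'])
    have h3 : (|l.1| ^ ((n : ℝ) / 4)) ^ 2 = √|l.1| ^ n := by
      rw [← Real.rpow_natCast, ← Real.rpow_natCast, ← Real.rpow_mul hl.le, Real.sqrt_eq_rpow,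
        ← Real.rpow_mul hl.le]
      congr 1
      push_cast
      ring
    rw [norm_sq_eq_integral, norm_sq_eq_integral, h1, h2, integral_const_mul,
      Measure.integral_comp_smul (volume : Measure (Rn n)) (fun s => ‖f s‖ ^ 2), h3,
      finrank_euclideanSpace_fin, smul_eq_mul, ← mul_assoc,
      abs_of_pos (inv_pos.2 (pow_pos hs n)),
      mul_inv_cancel₀ (pow_pos hs n).ne', one_mul]
  exact (pow_left_inj₀ (norm_nonneg _) (norm_nonneg _) two_ne_zero).1 h

theorem etaFun_zero (η : 𝓢(Rn n, ℂ)) (l : Rstar) (s : Rn n) :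
    etaFun η l 0 0 s = ((|l.1| ^ ((n : ℝ) / 4) : ℝ) : ℂ) * η (√|l.1| • s) := by
  simp [etaFun]

theorem norm_etaL2_zero (η : 𝓢(Rn n, ℂ)) (l : Rstar) : ‖etaL2 η l 0‖ = ‖η.toLp 2 volume‖ := by
  refine norm_eq_of_dilation l (η.coeFn_toLp 2 (volume : Measure (Rn n))) ?_
  filter_upwards [coeFn_etaL2 η l 0] with s hs
  rw [hs]
  exact etaFun_zero η l s

theorem norm_etaL2 (η : 𝓢(Rn n, ℂ)) (l : Rstar) (u : R2n n) :
    ‖etaL2 η l u‖ = ‖η.toLp 2 volume‖ := by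
  rw [etaL2_eq_tfShift, LinearIsometry.norm_map, norm_etaL2_zero]

/-- After undoing the dilation, `σ_v` is a time-frequency shift by a vector of length
`O(|λ|^{1/2})`. -/
theorem norm_dualShift_etaL2_sub (η : 𝓢(Rn n, ℂ)) (l : Rstar) (v : R2n n) :
    ‖dualShift l v (etaL2 η l 0) - etaL2 η l 0‖
      = ‖tfShift (-((l.1 / √|l.1|) • v.snd)) (√|l.1| • v.fst) (η.toLp 2) -
          (η.toLp 2 : L2Rn n)‖ := by
  have hs : √|l.1| ≠ 0 := (Real.sqrt_pos.2 (abs_pos.2 l.2)).ne'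
  refine norm_eq_of_dilation l (f := fun s : Rn n => planeWave (-((l.1 / √|l.1|) • v.snd)) s *
    η (s + √|l.1| • v.fst) - η s) ?_ ?_
  · filter_upwards [Lp.coeFn_sub (tfShift (-((l.1 / √|l.1|) • v.snd)) (√|l.1| • v.fst)
      (η.toLp 2)) (η.toLp 2), η.coeFn_toLp 2 (volume : Measure (Rn n)),
      coeFn_tfShift (-((l.1 / √|l.1|) • v.snd)) (√|l.1| • v.fst) (η.toLp 2),
      (measurePreserving_add_right (volume : Measure (Rn n))
        (√|l.1| • v.fst)).quasiMeasurePreserving.ae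
          (η.coeFn_toLp 2 (volume : Measure (Rn n)))] with s h1 h2 h3 h4
    rw [h1, Pi.sub_apply, h2, h3, h4]
  · filter_upwards [Lp.coeFn_sub (dualShift l v (etaL2 η l 0)) (etaL2 η l 0), coeFn_etaL2 η l 0,
      coeFn_tfShift (-(l.1 • v.snd)) v.fst (etaL2 η l 0),
      (measurePreserving_add_right (volume : Measure (Rn n))
        v.fst).quasiMeasurePreserving.ae (coeFn_etaL2 η l 0)] with s h1 h2 h3 h4
    rw [h1, Pi.sub_apply, h2, dualShift, h3, h4, WithLp.zero_fst, WithLp.zero_snd, etaFun_zero,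
      etaFun_zero, smul_add, planeWave_apply, planeWave_apply]
    have h5 : ⟪-((l.1 / √|l.1|) • v.snd), √|l.1| • s⟫_ℝ = ⟪-(l.1 • v.snd), s⟫_ℝ := by
      simp only [inner_neg_left, real_inner_smul_left, real_inner_smul_right]
      field_simp
    rw [h5]
    ring

theorem tendsto_dualShift_etaL2 (η : 𝓢(Rn n, ℂ)) (v : R2n n) :
    Tendsto (fun l : Rstar => ‖dualShift l v (etaL2 η l 0) - etaL2 η l 0‖) nearZero (𝓝 0) := by
  simp only [norm_dualShift_etaL2_sub]
  have h0 : Tendsto (fun l : Rstar => l.1) nearZero (𝓝 0) := tendsto_comap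
  have h1 : Tendsto (fun l : Rstar => √|l.1|) nearZero (𝓝 0) := by
    have := (Real.continuous_sqrt.comp continuous_abs).tendsto (0 : ℝ)
    simp only [Function.comp_def, abs_zero, Real.sqrt_zero] at this
    exact this.comp h0
  have h2 : Tendsto (fun l : Rstar => l.1 / √|l.1|) nearZero (𝓝 0) := by
    refine squeeze_zero_norm (fun l => ?_) h1
    rw [norm_div, Real.norm_eq_abs, Real.norm_eq_abs, abs_of_nonneg (Real.sqrt_nonneg _),
      Real.div_sqrt]
  have h3 : Tendsto (fun l : Rstar => (-((l.1 / √|l.1|) • v.snd), √|l.1| • v.fst)) nearZero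
      (𝓝 ((0 : Rn n), (0 : Rn n))) := by
    have ha := (h2.smul_const v.snd).neg
    have hb := h1.smul_const v.fst
    rw [zero_smul] at ha hb
    rw [neg_zero] at ha
    exact ha.prodMk_nhds hb
  have h4 := ((continuous_tfShift (η.toLp 2)).tendsto (0, 0)).comp h3
  simp only [tfShift_zero] at h4
  exact tendsto_iff_norm_sub_tendsto_zero.1 h4

end Eta

/-! ### The Fourier transform of `C⋆(ℝ²ⁿ)` -/

section GroupCStar

variable {n : ℕ}

theorem coeFn_translate (v : R2n n) (ξ : L2R2n n) :
    translate v ξ =ᵐ[volume] fun x => ξ (x - v) :=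
  Lp.coeFn_compMeasurePreserving ξ (measurePreserving_sub_right volume v)

theorem continuous_translate_apply (v : R2n n) : Continuous (translate (n := n) v) :=
  (Lp.isometry_compMeasurePreserving (measurePreserving_sub_right volume v)).continuous

theorem translate_toLp (v : R2n n) (f : 𝓢(R2n n, ℂ)) :
    translate v (f.toLp 2 : L2R2n n) = (f.compSubConstCLM ℂ v).toLp 2 := by
  refine Lp.ext ?_
  filter_upwards [coeFn_translate v (f.toLp 2),
    (f.compSubConstCLM ℂ v).coeFn_toLp 2 (volume : Measure (R2n n)),
    (measurePreserving_sub_right (volume : Measure (R2n n)) v).quasiMeasurePreserving.ae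
      (f.coeFn_toLp 2 (volume : Measure (R2n n)))] with x h1 h2 h3
  rw [h1, h2, h3, SchwartzMap.compSubConstCLM_apply]

theorem fourier_compSubConst_toLp (v : R2n n) (f : 𝓢(R2n n, ℂ)) :
    ((𝓕 (f.compSubConstCLM ℂ v)).toLp 2 : L2R2n n)
      = mulOp (planeWave (-v)) ((𝓕 f).toLp 2 : L2R2n n) := by
  refine Lp.ext ?_
  filter_upwards [coeFn_mulOp (planeWave (-v)) ((𝓕 f).toLp 2 : L2R2n n),
    (𝓕 f).coeFn_toLp 2 (volume : Measure (R2n n)),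
    (𝓕 (f.compSubConstCLM ℂ v)).coeFn_toLp 2 (volume : Measure (R2n n))] with u h2 h3 h4
  rw [h2, h3, h4, SchwartzMap.fourier_coe, SchwartzMap.fourier_coe]
  have h5 := congrFun (VectorFourier.fourierIntegral_comp_add_right Real.fourierChar
    (volume : Measure (R2n n)) (innerₗ (R2n n)) (f : R2n n → ℂ) (-v)) u
  have h6 : ⇑(f.compSubConstCLM ℂ v) = (f : R2n n → ℂ) ∘ fun x => x + -v := by
    ext x
    rw [SchwartzMap.compSubConstCLM_apply, Function.comp_apply, sub_eq_add_neg]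
  rw [h6]
  exact h5

/-- The Fourier transform intertwines translations and multiplications by plane waves. -/
theorem fourier_translate (v : R2n n) (ξ : L2R2n n) :
    Lp.fourierTransformₗᵢ (R2n n) ℂ (translate v ξ)
      = mulOp (planeWave (-v)) (Lp.fourierTransformₗᵢ (R2n n) ℂ ξ) := by
  refine DenseRange.induction_on (p := fun ξ : L2R2n n =>
    Lp.fourierTransformₗᵢ (R2n n) ℂ (translate v ξ)
      = mulOp (planeWave (-v)) (Lp.fourierTransformₗᵢ (R2n n) ℂ ξ))
    (SchwartzMap.denseRange_toLpCLM (E := R2n n) (F := ℂ) (p := 2) (μ := volume)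
      ENNReal.ofNat_ne_top) ξ ?_ fun f => ?_
  · exact isClosed_eq ((LinearIsometryEquiv.continuous _).comp (continuous_translate_apply v))
      ((mulOp (planeWave (-v))).continuous.comp (LinearIsometryEquiv.continuous _))
  · have h1 := congrArg (Lp.fourierTransformₗᵢ (R2n n) ℂ) (translate_toLp v f)
    have h2 := congrArg (mulOp (planeWave (-v))) (SchwartzMap.toLp_fourier_eq f)
    exact h1.trans ((SchwartzMap.toLp_fourier_eq (f.compSubConstCLM ℂ v)).trans
      ((fourier_compSubConst_toLp v f).trans h2.symm))

theorem fourierL1_apply (f : R2n n →₁[volume] ℂ) (u : R2n n) :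
    fourierL1 f u = 𝓕 (f : R2n n → ℂ) u := rfl

theorem norm_conjStarAlgEquiv {H K : Type*} [NormedAddCommGroup H] [InnerProductSpace ℂ H]
    [CompleteSpace H] [NormedAddCommGroup K] [InnerProductSpace ℂ K] [CompleteSpace K]
    (e : H ≃ₗᵢ[ℂ] K) (A : H →L[ℂ] H) : ‖e.conjStarAlgEquiv A‖ = ‖A‖ := by
  refine le_antisymm ?_ ?_
  · refine ContinuousLinearMap.opNorm_le_bound _ (norm_nonneg _) fun y => ?_
    simpa using A.le_opNorm (e.symm y)
  · refine ContinuousLinearMap.opNorm_le_bound _ (norm_nonneg _) fun x => ?_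
    simpa using (e.conjStarAlgEquiv A).le_opNorm (e x)

/-- The operator on `L²(ℝ²ⁿ)` with Fourier multiplier `g`. -/
def fourierMul (g : R2n n →ᵇ ℂ) : L2R2n n →L[ℂ] L2R2n n :=
  (Lp.fourierTransformₗᵢ (R2n n) ℂ).symm.conjStarAlgEquiv (mulOp g)

theorem fourierMul_apply (g : R2n n →ᵇ ℂ) (ξ : L2R2n n) :
    fourierMul g ξ = (Lp.fourierTransformₗᵢ (R2n n) ℂ).symm
      (mulOp g (Lp.fourierTransformₗᵢ (R2n n) ℂ ξ)) := rfl

theorem fourierMul_add (g g' : R2n n →ᵇ ℂ) :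
    fourierMul (g + g') = fourierMul g + fourierMul g' := by
  unfold fourierMul
  rw [(mulOp (V := R2n n)).map_add g g']
  exact map_add _ _ _

theorem fourierMul_smul (c : ℂ) (g : R2n n →ᵇ ℂ) :
    fourierMul (c • g) = c • fourierMul g := by
  unfold fourierMul
  rw [(mulOp (V := R2n n)).map_smul c g]
  exact map_smul _ _ _

theorem fourierMul_mul (g g' : R2n n →ᵇ ℂ) :
    fourierMul (g * g') = fourierMul g * fourierMul g' := by
  unfold fourierMul
  have h : mulOp (g * g') = mulOp g * mulOp (V := R2n n) g' :=
    ContinuousLinearMap.ext fun ξ => mulOp_mul g g' ξ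
  rw [h]
  exact map_mul _ _ _

theorem fourierMul_star (g : R2n n →ᵇ ℂ) : fourierMul (star g) = star (fourierMul g) := by
  unfold fourierMul
  rw [← star_mulOp g]
  exact map_star _ _

theorem norm_fourierMul (g : R2n n →ᵇ ℂ) : ‖fourierMul g‖ = ‖g‖ :=
  (norm_conjStarAlgEquiv _ _).trans (norm_mulOp g)

/-- The Fourier multiplier as a function of the symbol, as a linear isometry. -/
def fourierMulₗᵢ (n : ℕ) : (R2n n →ᵇ ℂ) →ₗᵢ[ℂ] L2R2n n →L[ℂ] L2R2n n where
  toFun := fourierMul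
  map_add' := fourierMul_add
  map_smul' := fourierMul_smul
  norm_map' := norm_fourierMul

theorem fourierMul_injective : Function.Injective (fourierMul (n := n)) :=
  (fourierMulₗᵢ n).injective

theorem continuous_fourierMul : Continuous (fourierMul (n := n)) :=
  (fourierMulₗᵢ n).continuous

theorem convOp_apply (f : R2n n →₁[volume] ℂ) (ξ : L2R2n n) :
    convOp f ξ = ∫ v : R2n n, f v • translate v ξ := rfl

/-- Convolution by `f` is the operator with Fourier multiplier `f̂`. -/
theorem convOp_eq_fourierMul (f : R2n n →₁[volume] ℂ) :
    convOp f = fourierMul (fourierL1 f).toBCF := by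
  ext1 ξ
  rw [fourierMul_apply, LinearIsometryEquiv.eq_symm_apply, convOp_apply,
    mulOp_eq_integral (L1.integrable_coeFn f) (g := (fourierL1 f).toBCF) (fun u => rfl)]
  have h := ContinuousLinearMap.integral_comp_comm
    ((Lp.fourierTransformₗᵢ (R2n n) ℂ).toContinuousLinearEquiv : L2R2n n →L[ℂ] L2R2n n)
    (integrable_smul_translate f ξ)
  refine h.symm.trans (integral_congr_ae (Eventually.of_forall fun v => ?_))
  exact ((Lp.fourierTransformₗᵢ (R2n n) ℂ).map_smul (f v) (translate v ξ)).trans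
    (congrArg _ (fourier_translate v ξ))

theorem norm_convOp (f : R2n n →₁[volume] ℂ) : ‖convOp f‖ = ‖fourierL1 f‖ := by
  rw [convOp_eq_fourierMul, norm_fourierMul, ZeroAtInftyContinuousMap.norm_toBCF_eq_norm]

theorem norm_convOp_le (f : R2n n →₁[volume] ℂ) : ‖convOp f‖ ≤ ‖f‖ :=
  LinearMap.mkContinuous_norm_le _ (norm_nonneg _) _

theorem fourierL1_add (f g : R2n n →₁[volume] ℂ) :
    fourierL1 (f + g) = fourierL1 f + fourierL1 g := by
  ext u
  rw [ZeroAtInftyContinuousMap.add_apply]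
  simp only [fourierL1_apply, Real.fourier_eq]
  rw [← integral_add ((Real.fourierIntegral_convergent_iff u).2 (L1.integrable_coeFn f))
    ((Real.fourierIntegral_convergent_iff u).2 (L1.integrable_coeFn g))]
  refine integral_congr_ae ?_
  filter_upwards [Lp.coeFn_add f g] with x hx
  rw [hx, Pi.add_apply, smul_add]

theorem fourierL1_smul (c : ℂ) (f : R2n n →₁[volume] ℂ) : fourierL1 (c • f) = c • fourierL1 f := by
  ext u
  rw [ZeroAtInftyContinuousMap.smul_apply]
  simp only [fourierL1_apply, Real.fourier_eq]
  rw [← integral_smul]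
  refine integral_congr_ae ?_
  filter_upwards [Lp.coeFn_smul c f] with x hx
  rw [hx, Pi.smul_apply, smul_comm]

theorem convOp_add (f g : R2n n →₁[volume] ℂ) : convOp (f + g) = convOp f + convOp g := by
  rw [convOp_eq_fourierMul, convOp_eq_fourierMul, convOp_eq_fourierMul, ← fourierMul_add,
    fourierL1_add]
  rfl

theorem convOp_smul (c : ℂ) (f : R2n n →₁[volume] ℂ) : convOp (c • f) = c • convOp f := by
  rw [convOp_eq_fourierMul, convOp_eq_fourierMul, ← fourierMul_smul, fourierL1_smul]
  rfl

theorem continuous_convOp : Continuous (convOp (n := n)) :=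
  (LinearMap.mkContinuous
    ({ toFun := convOp, map_add' := convOp_add, map_smul' := convOp_smul } :
      (R2n n →₁[volume] ℂ) →ₗ[ℂ] (L2R2n n →L[ℂ] L2R2n n)) 1
    fun f => (norm_convOp_le f).trans (one_mul ‖f‖).ge).continuous

theorem fourierL1_toLp (f : 𝓢(R2n n, ℂ)) (u : R2n n) :
    fourierL1 (f.toLp 1) u = 𝓕 (f : R2n n → ℂ) u := by
  rw [fourierL1_apply, Real.fourier_eq, Real.fourier_eq]
  refine integral_congr_ae ?_
  filter_upwards [f.coeFn_toLp 1 (volume : Measure (R2n n))] with x hx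
  rw [hx]

theorem convOp_toLp (f : 𝓢(R2n n, ℂ)) :
    convOp (f.toLp 1) = fourierMul (𝓕 f : 𝓢(R2n n, ℂ)).toBoundedContinuousFunction := by
  rw [convOp_eq_fourierMul]
  congr 1
  ext u
  exact fourierL1_toLp f u

/-- The star algebra of convolution operators with Schwartz functions. It makes Schwartz functions
dense in `C⋆(ℝ²ⁿ)`. -/
def schwartzConv (n : ℕ) : NonUnitalStarSubalgebra ℂ (L2R2n n →L[ℂ] L2R2n n) where
  carrier := Set.range fun f : 𝓢(R2n n, ℂ) => convOp (f.toLp 1)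
  zero_mem' := ⟨0, by
    have h : (𝓕 (0 : 𝓢(R2n n, ℂ)) : 𝓢(R2n n, ℂ)).toBoundedContinuousFunction = 0 := by
      ext u
      simp [FourierTransform.fourier_zero]
    change convOp ((0 : 𝓢(R2n n, ℂ)).toLp 1) = 0
    rw [convOp_toLp, h]
    exact (fourierMulₗᵢ n).map_zero⟩
  add_mem' := by
    rintro _ _ ⟨f, rfl⟩ ⟨g, rfl⟩
    refine ⟨f + g, ?_⟩
    simp only [convOp_toLp]
    rw [← fourierMul_add]
    congr 1
    ext u
    simp [FourierTransform.fourier_add]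
  mul_mem' := by
    rintro _ _ ⟨f, rfl⟩ ⟨g, rfl⟩
    refine ⟨SchwartzMap.convolution (ContinuousLinearMap.mul ℂ ℂ) f g, ?_⟩
    simp only [convOp_toLp]
    rw [← fourierMul_mul]
    congr 1
    ext u
    have h := congrArg (fun k : 𝓢(R2n n, ℂ) => k u)
      (SchwartzMap.fourier_convolution (ContinuousLinearMap.mul ℂ ℂ) f g)
    exact h
  smul_mem' := by
    rintro c _ ⟨f, rfl⟩
    refine ⟨c • f, ?_⟩
    simp only [convOp_toLp]
    rw [← fourierMul_smul]
    congr 1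
    ext u
    simp [FourierTransform.fourier_smul]
  star_mem' := by
    rintro _ ⟨f, rfl⟩
    refine ⟨𝓕⁻ ((𝓕 f).postcompCLM (𝕜 := ℝ) (Complex.conjCLE : ℂ →L[ℝ] ℂ)), ?_⟩
    simp only [convOp_toLp]
    rw [← fourierMul_star]
    congr 1
    ext u
    simp only [FourierTransform.fourier_fourierInv_eq]
    rfl

theorem convOp_mem_closure_schwartzConv (f : R2n n →₁[volume] ℂ) :
    convOp f ∈ (schwartzConv n).topologicalClosure :=
  (continuous_convOp.range_subset_closure_image_dense
    (SchwartzMap.denseRange_toLpCLM (E := R2n n) (F := ℂ) (p := 1) (μ := volume)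
      ENNReal.one_ne_top)).trans (closure_mono (by
        rintro _ ⟨_, ⟨f, rfl⟩, rfl⟩
        exact ⟨f, rfl⟩)) ⟨f, rfl⟩

theorem convAlgebra_le : convAlgebra n ≤ (schwartzConv n).topologicalClosure := by
  refine NonUnitalStarSubalgebra.topologicalClosure_minimal _ ?_
    (NonUnitalStarSubalgebra.isClosed_topologicalClosure _)
  refine NonUnitalStarAlgebra.adjoin_le ?_
  rintro _ ⟨f, rfl⟩
  exact convOp_mem_closure_schwartzConv f

theorem norm_def_CStarR2n (h : CStarR2n n) : ‖h‖ = ‖h.1‖ := rfl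

theorem denseRange_ofSchwartz : DenseRange (ofSchwartz (n := n)) := by
  intro h
  rw [Metric.mem_closure_range_iff]
  intro ε hε
  obtain ⟨_, ⟨f, rfl⟩, hf⟩ := Metric.mem_closure_iff.1 (convAlgebra_le h.2) ε hε
  exact ⟨f, hf⟩

theorem denseRange_ofL1 : DenseRange (ofL1 (n := n)) :=
  denseRange_ofSchwartz.mono (by
    rintro _ ⟨f, rfl⟩
    exact ⟨f.toLp 1, rfl⟩)

/-- The Fourier transform on `C⋆(ℝ²ⁿ)` as a continuous linear map. -/
def hatCLM (n : ℕ) : CStarR2n n →L[ℂ] C₀(R2n n, ℂ) :=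
  LinearMap.extendOfNorm
    ({ toFun := fourierL1, map_add' := fourierL1_add, map_smul' := fourierL1_smul } :
      (R2n n →₁[volume] ℂ) →ₗ[ℂ] C₀(R2n n, ℂ))
    { toFun := ofL1
      map_add' := fun f g => Subtype.ext (convOp_add f g)
      map_smul' := fun c f => Subtype.ext (convOp_smul c f) }

theorem hatCLM_ofL1 (f : R2n n →₁[volume] ℂ) : hatCLM n (ofL1 f) = fourierL1 f :=
  LinearMap.extendOfNorm_eq denseRange_ofL1 ⟨1, fun f => by
    rw [one_mul]
    exact (norm_convOp f).ge⟩ f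

theorem comap_nhds_neBot {X Y : Type*} [TopologicalSpace Y] {e : X → Y} (he : DenseRange e)
    (y : Y) : (comap e (𝓝 y)).NeBot :=
  comap_neBot fun _ ht => he.mem_nhds ht

theorem hat_eq_hatCLM (h : CStarR2n n) : hat h = hatCLM n h := by
  have := comap_nhds_neBot denseRange_ofL1 h
  refine Tendsto.limUnder_eq ?_
  have h1 : Tendsto (fun f => hatCLM n (ofL1 f)) (comap ofL1 (𝓝 h)) (𝓝 (hatCLM n h)) :=
    ((hatCLM n).continuous.tendsto h).comp tendsto_comap
  simpa only [hatCLM_ofL1] using h1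

theorem hat_ofL1 (f : R2n n →₁[volume] ℂ) : hat (ofL1 f) = fourierL1 f := by
  rw [hat_eq_hatCLM, hatCLM_ofL1]

theorem hat_add (h h' : CStarR2n n) : hat (h + h') = hat h + hat h' := by
  simp only [hat_eq_hatCLM, map_add]

theorem hat_sub (h h' : CStarR2n n) : hat (h - h') = hat h - hat h' := by
  simp only [hat_eq_hatCLM, map_sub]

theorem hat_smul (c : ℂ) (h : CStarR2n n) : hat (c • h) = c • hat h := by
  simp only [hat_eq_hatCLM, map_smul]

theorem continuous_hat : Continuous (hat (n := n)) := by
  rw [funext hat_eq_hatCLM]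
  exact (hatCLM n).continuous

theorem continuous_toBCF : Continuous fun g : C₀(R2n n, ℂ) => g.toBCF :=
  ZeroAtInftyContinuousMap.isometry_toBCF.continuous

/-- Every element of `C⋆(ℝ²ⁿ)` is a Fourier multiplier, whose symbol is its Fourier transform. -/
theorem coe_eq_fourierMul (h : CStarR2n n) : h.1 = fourierMul (hat h).toBCF := by
  refine denseRange_ofL1.induction_on (p := fun h : CStarR2n n => h.1 = fourierMul (hat h).toBCF)
    h ?_ fun f => ?_
  · exact isClosed_eq continuous_subtype_val
      (continuous_fourierMul.comp (continuous_toBCF.comp continuous_hat))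
  · rw [hat_ofL1, ← convOp_eq_fourierMul]
    rfl

theorem norm_hat (h : CStarR2n n) : ‖hat h‖ = ‖h‖ := by
  rw [norm_def_CStarR2n, coe_eq_fourierMul h, norm_fourierMul,
    ZeroAtInftyContinuousMap.norm_toBCF_eq_norm]

theorem toBCF_hat_mul (h h' : CStarR2n n) :
    (hat (h * h')).toBCF = (hat h).toBCF * (hat h').toBCF := by
  refine fourierMul_injective ?_
  rw [fourierMul_mul, ← coe_eq_fourierMul, ← coe_eq_fourierMul, ← coe_eq_fourierMul]
  rfl

theorem toBCF_hat_star (h : CStarR2n n) : (hat (star h)).toBCF = star (hat h).toBCF := by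
  refine fourierMul_injective ?_
  rw [fourierMul_star, ← coe_eq_fourierMul, ← coe_eq_fourierMul]
  rfl

end GroupCStar

/-! ### The operators `ν_λ(f)` for Schwartz functions `f` -/

section Schwartz

variable {n : ℕ}

theorem integral_mem_of_isClosed {α E : Type*} [MeasurableSpace α] {μ : Measure α}
    [NormedAddCommGroup E] [NormedSpace ℂ E] [CompleteSpace E] (K : Submodule ℂ E)
    (hK : IsClosed (K : Set E)) {f : α → E} (hf : ∀ x, f x ∈ K) : ∫ x, f x ∂μ ∈ K := by
  by_cases hi : Integrable f μ
  · have : IsClosed (K : Set E) := hK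
    have h := ContinuousLinearMap.integral_comp_comm K.mkQL hi
    have h0 : ∀ x, K.mkQL (f x) = 0 := fun x => (Submodule.Quotient.mk_eq_zero K).2 (hf x)
    simp only [h0, integral_zero] at h
    exact (Submodule.Quotient.mk_eq_zero K).1 h.symm
  · rw [integral_undef hi]
    exact K.zero_mem

theorem lineProj_apply {ξ : L2Rn n} (hξ : ‖ξ‖ = 1) (ζ : L2Rn n) :
    lineProj ξ ζ = ⟪ξ, ζ⟫_ℂ • ξ :=
  Submodule.starProjection_unit_singleton ℂ hξ ζ

theorem lineProj_eq_smulRightL {ξ : L2Rn n} (hξ : ‖ξ‖ = 1) :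
    lineProj ξ = ContinuousLinearMap.smulRightL ℂ (L2Rn n) (L2Rn n) (innerSL ℂ ξ) ξ := by
  ext1 ζ
  rw [lineProj_apply hξ]
  rfl

theorem norm_lineProj_le (ξ : L2Rn n) : ‖lineProj ξ‖ ≤ 1 :=
  Submodule.starProjection_norm_le _

theorem isCompactOperator_lineProj (ξ : L2Rn n) : IsCompactOperator (lineProj ξ) := by
  have h : IsCompactOperator ((ℂ ∙ ξ).orthogonalProjectionOnto : L2Rn n →L[ℂ] (ℂ ∙ ξ)) :=
    have := FiniteDimensional.proper ℂ (ℂ ∙ ξ)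
    isCompactOperator_of_locallyCompactSpace_dom _
  exact h.clm_comp (ℂ ∙ ξ).subtypeL

theorem continuous_lineProj {X : Type*} [TopologicalSpace X] {ξ : X → L2Rn n} (hξ : Continuous ξ)
    (hn : ∀ x, ‖ξ x‖ = 1) : Continuous fun x => lineProj (ξ x) := by
  rw [funext fun x => lineProj_eq_smulRightL (hn x)]
  exact ((ContinuousLinearMap.smulRightL ℂ (L2Rn n) (L2Rn n)).continuous.comp
    ((innerSL ℂ).continuous.comp hξ)).clm_apply hξ

theorem continuous_etaL2_right (η : 𝓢(Rn n, ℂ)) (l : Rstar) :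
    Continuous fun u : R2n n => etaL2 η l u := by
  rw [funext fun u => etaL2_eq_tfShift η l u]
  exact (continuous_tfShift _).comp (((WithLp.prod_continuous_ofLp 2 (Rn n) (Rn n)).fst).prodMk
    ((WithLp.prod_continuous_ofLp 2 (Rn n) (Rn n)).snd.const_smul l.1⁻¹))

theorem continuous_etaL2_left (η : 𝓢(Rn n, ℂ)) (u : R2n n) :
    Continuous fun l : Rstar => etaL2 η l u := by
  refine continuous_iff_continuousAt.2 fun l₀ => ?_
  refine tendsto_of_tendsto_ae_of_norm_eq (fun l => coeFn_etaL2 η l u) (coeFn_etaL2 η l₀ u)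
    (Eventually.of_forall fun s => ?_)
    fun l => (norm_etaL2 η l u).trans (norm_etaL2 η l₀ u).symm
  have h1 : Continuous fun l : Rstar => |l.1| := continuous_abs.comp continuous_subtype_val
  have h2 : Continuous fun l : Rstar => |l.1| ^ ((n : ℝ) / 4) :=
    h1.rpow_const fun l => Or.inl (abs_pos.2 l.2).ne'
  have h3 : Continuous fun l : Rstar => l.1⁻¹ :=
    continuous_subtype_val.inv₀ fun l => l.2
  have h4 : Continuous fun l : Rstar => η (√|l.1| • (s + l.1⁻¹ • u.snd)) :=
    η.continuous.comp ((Real.continuous_sqrt.comp h1).smul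
      (continuous_const.add (h3.smul continuous_const)))
  exact (((Complex.continuous_ofReal.comp h2).mul continuous_const).mul h4).tendsto l₀

theorem integrable_fourier (f : 𝓢(R2n n, ℂ)) : Integrable (𝓕 (f : R2n n → ℂ)) := by
  rw [← SchwartzMap.fourier_coe]
  exact (𝓕 f).integrable

theorem norm_nuIntegrand_le (η : 𝓢(Rn n, ℂ)) (l : Rstar) (f : 𝓢(R2n n, ℂ)) (u : R2n n) :
    ‖nuIntegrand η l f u‖ ≤ ‖𝓕 (f : R2n n → ℂ) u‖ * (|l.1| ^ n)⁻¹ := by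
  rw [nuIntegrand, norm_smul, norm_div, Complex.norm_real, Real.norm_of_nonneg (by positivity),
    div_eq_mul_inv]
  exact mul_le_of_le_one_right (by positivity) (norm_lineProj_le _)

theorem aestronglyMeasurable_nuIntegrand {η : 𝓢(Rn n, ℂ)} (hη : ‖η.toLp 2 volume‖ = 1) (l : Rstar)
    (f : 𝓢(R2n n, ℂ)) : AEStronglyMeasurable (nuIntegrand η l f) volume := by
  have h : AEStronglyMeasurable (fun u => 𝓕 (f : R2n n → ℂ) u / ((|l.1| ^ n : ℝ) : ℂ)) volume := by
    simp only [div_eq_mul_inv]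
    exact (integrable_fourier f).1.mul_const _
  exact h.smul (continuous_lineProj (continuous_etaL2_right η l)
    fun u => (norm_etaL2 η l u).trans hη).aestronglyMeasurable

theorem integrable_nuIntegrand {η : 𝓢(Rn n, ℂ)} (hη : ‖η.toLp 2 volume‖ = 1) (l : Rstar)
    (f : 𝓢(R2n n, ℂ)) : Integrable (nuIntegrand η l f) :=
  ((integrable_fourier f).norm.mul_const _).mono' (aestronglyMeasurable_nuIntegrand hη l f)
    (Eventually.of_forall (norm_nuIntegrand_le η l f))

theorem isCompactOperator_integral_nuIntegrand (η : 𝓢(Rn n, ℂ)) (l : Rstar) (f : 𝓢(R2n n, ℂ)) :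
    IsCompactOperator (∫ u, nuIntegrand η l f u : L2Rn n →L[ℂ] L2Rn n) :=
  integral_mem_of_isClosed (compactOperator (RingHom.id ℂ) (L2Rn n) (L2Rn n))
    isClosed_setOfPred_isCompactOperator
    fun u => (isCompactOperator_lineProj (etaL2 η l u)).smul
      (𝓕 (f : R2n n → ℂ) u / ((|l.1| ^ n : ℝ) : ℂ))

theorem norm_integral_nuIntegrand_le (η : 𝓢(Rn n, ℂ)) (l : Rstar) (f : 𝓢(R2n n, ℂ)) :
    ‖∫ u, nuIntegrand η l f u‖ ≤ (∫ u, ‖𝓕 (f : R2n n → ℂ) u‖) * (|l.1| ^ n)⁻¹ := by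
  rw [← integral_mul_const]
  exact norm_integral_le_of_norm_le ((integrable_fourier f).norm.mul_const _)
    (Eventually.of_forall (norm_nuIntegrand_le η l f))

/-- `‖ν_λ(f)‖ = O(|λ|⁻ⁿ)`. -/
theorem tendsto_integral_nuIntegrand_nearInfinity (hn : 1 ≤ n) (η : 𝓢(Rn n, ℂ))
    (f : 𝓢(R2n n, ℂ)) :
    Tendsto (fun l : Rstar => ‖∫ u, nuIntegrand η l f u‖) nearInfinity (𝓝 0) := by
  have h1 : Tendsto (fun l : Rstar => (|l.1| ^ n)⁻¹) nearInfinity (𝓝 0) :=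
    ((tendsto_pow_atTop (by omega)).comp tendsto_comap).inv_tendsto_atTop
  have h2 := h1.const_mul (∫ u, ‖𝓕 (f : R2n n → ℂ) u‖)
  rw [mul_zero] at h2
  exact squeeze_zero (fun l => norm_nonneg _) (fun l => norm_integral_nuIntegrand_le η l f) h2

theorem continuous_integral_nuIntegrand {η : 𝓢(Rn n, ℂ)} (hη : ‖η.toLp 2 volume‖ = 1)
    (f : 𝓢(R2n n, ℂ)) :
    Continuous fun l : Rstar => ∫ u, nuIntegrand η l f u := by
  refine continuous_iff_continuousAt.2 fun l₀ => ?_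
  have hc : Continuous fun l : Rstar => (|l.1| ^ n)⁻¹ :=
    ((continuous_abs.comp continuous_subtype_val).pow n).inv₀
      fun l => pow_ne_zero _ (abs_pos.2 l.2).ne'
  have hev : ∀ᶠ l : Rstar in 𝓝 l₀, (|l.1| ^ n)⁻¹ ≤ (|l₀.1| ^ n)⁻¹ + 1 :=
    (hc.tendsto l₀).eventually_le_const (by linarith)
  refine tendsto_integral_filter_of_dominated_convergence
    (fun u => ‖𝓕 (f : R2n n → ℂ) u‖ * ((|l₀.1| ^ n)⁻¹ + 1))
    (Eventually.of_forall fun l => aestronglyMeasurable_nuIntegrand hη l f) ?_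
    ((integrable_fourier f).norm.mul_const _) (Eventually.of_forall fun u => ?_)
  · filter_upwards [hev] with l hl
    exact Eventually.of_forall fun u => (norm_nuIntegrand_le η l f u).trans
      (mul_le_mul_of_nonneg_left hl (norm_nonneg _))
  · refine Continuous.tendsto ?_ l₀
    have h : Continuous fun l : Rstar => 𝓕 (f : R2n n → ℂ) u / ((|l.1| ^ n : ℝ) : ℂ) :=
      continuous_const.div (Complex.continuous_ofReal.comp
        ((continuous_abs.comp continuous_subtype_val).pow n))
        fun l => Complex.ofReal_ne_zero.2 (pow_ne_zero _ (abs_pos.2 l.2).ne')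
    exact h.smul (continuous_lineProj (continuous_etaL2_left η u)
      fun l => (norm_etaL2 η l u).trans hη)

theorem hat_ofSchwartz_apply (f : 𝓢(R2n n, ℂ)) (u : R2n n) :
    hat (ofSchwartz f) u = 𝓕 (f : R2n n → ℂ) u := by
  rw [ofSchwartz, hat_ofL1, fourierL1_toLp]

/-- The operator `ν_λ(f)` is the Toeplitz operator with symbol `f̂`. -/
theorem integral_nuIntegrand_eq_toeplitz {η : 𝓢(Rn n, ℂ)} (hη : ‖η.toLp 2 volume‖ = 1) (l : Rstar)
    (f : 𝓢(R2n n, ℂ)) :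
    ∫ u, nuIntegrand η l f u = toeplitz l (etaL2 η l 0) (hat (ofSchwartz f)).toBCF := by
  ext1 ξ
  refine ext_inner_left ℂ fun ζ => ?_
  have hl : 0 < |l.1| ^ n := pow_pos (abs_pos.2 l.2) n
  have hi := integrable_nuIntegrand hη l f
  rw [ContinuousLinearMap.integral_apply hi, ← integral_inner (hi.apply_continuousLinearMap ξ),
    inner_toeplitz, inner_mulOp]
  refine integral_congr_ae ?_
  filter_upwards [coeFn_coherentOp l (etaL2 η l 0) ζ, coeFn_coherentOp l (etaL2 η l 0) ξ]
    with u h1 h2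
  have hsq : ((√((|l.1| ^ n)⁻¹) : ℝ) : ℂ) * ((√((|l.1| ^ n)⁻¹) : ℝ) : ℂ)
      = ((|l.1| ^ n : ℝ) : ℂ)⁻¹ := by
    rw [← Complex.ofReal_mul, Real.mul_self_sqrt (inv_nonneg.2 hl.le), Complex.ofReal_inv]
  have hval : (hat (ofSchwartz f)).toBCF u = 𝓕 (f : R2n n → ℂ) u := hat_ofSchwartz_apply f u
  rw [h1, h2, hval, nuIntegrand, smul_apply, lineProj_apply ((norm_etaL2 η l u).trans hη),
    inner_smul_right, inner_smul_right, coherentFun, coherentFun, ← etaL2_eq_tfShift,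
    finrank_euclideanSpace_fin, RCLike.inner_apply, map_mul, Complex.conj_ofReal, inner_conj_symm,
    div_eq_mul_inv, ← hsq]
  ring

end Schwartz

/-! ### The map `ν` -/

section Nu

variable {n : ℕ}

theorem toLp_add (f g : 𝓢(R2n n, ℂ)) :
    (f + g).toLp 1 (volume : Measure (R2n n)) = f.toLp 1 volume + g.toLp 1 volume :=
  (SchwartzMap.toLpCLM ℂ ℂ 1 (volume : Measure (R2n n))).map_add f g

theorem toLp_smul (c : ℂ) (f : 𝓢(R2n n, ℂ)) :
    (c • f).toLp 1 (volume : Measure (R2n n)) = c • f.toLp 1 volume :=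
  (SchwartzMap.toLpCLM ℂ ℂ 1 (volume : Measure (R2n n))).map_smul c f

theorem ofL1_add (f g : R2n n →₁[volume] ℂ) : ofL1 (f + g) = ofL1 f + ofL1 g :=
  Subtype.ext (convOp_add f g)

theorem ofL1_smul (c : ℂ) (f : R2n n →₁[volume] ℂ) : ofL1 (c • f) = c • ofL1 f :=
  Subtype.ext (convOp_smul c f)

theorem ofSchwartz_add (f g : 𝓢(R2n n, ℂ)) : ofSchwartz (f + g) = ofSchwartz f + ofSchwartz g :=
  (congrArg ofL1 (toLp_add f g)).trans (ofL1_add (f.toLp 1 volume) (g.toLp 1 volume))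

theorem ofSchwartz_smul (c : ℂ) (f : 𝓢(R2n n, ℂ)) : ofSchwartz (c • f) = c • ofSchwartz f :=
  (congrArg ofL1 (toLp_smul c f)).trans (ofL1_smul c (f.toLp 1 volume))

theorem norm_toeplitz_hat_le {η : 𝓢(Rn n, ℂ)} (hη : ‖η.toLp 2 volume‖ = 1) (l : Rstar)
    (h : CStarR2n n) : ‖toeplitz l (etaL2 η l 0) (hat h).toBCF‖ ≤ ‖h‖ := by
  refine (norm_toeplitz_le l ((norm_etaL2_zero η l).trans hη) _).trans ?_
  rw [ZeroAtInftyContinuousMap.norm_toBCF_eq_norm, norm_hat]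

theorem norm_integral_nuIntegrand_le_norm {η : 𝓢(Rn n, ℂ)} (hη : ‖η.toLp 2 volume‖ = 1)
    (f : 𝓢(R2n n, ℂ)) (l : Rstar) : ‖∫ u, nuIntegrand η l f u‖ ≤ ‖ofSchwartz f‖ :=
  (congrArg norm (integral_nuIntegrand_eq_toeplitz hη l f)).trans_le (norm_toeplitz_hat_le hη l _)

/-- The field `λ ↦ ν_λ(f)` on `ℝ^*`, for a Schwartz function `f`. -/
def schwartzField {η : 𝓢(Rn n, ℂ)} (hη : ‖η.toLp 2 volume‖ = 1) (f : 𝓢(R2n n, ℂ)) :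
    Rstar →ᵇ (L2Rn n →L[ℂ] L2Rn n) :=
  BoundedContinuousFunction.ofNormedAddCommGroup (fun l => ∫ u, nuIntegrand η l f u)
    (continuous_integral_nuIntegrand hη f) ‖ofSchwartz f‖ (norm_integral_nuIntegrand_le_norm hη f)

theorem schwartzField_apply {η : 𝓢(Rn n, ℂ)} (hη : ‖η.toLp 2 volume‖ = 1) (f : 𝓢(R2n n, ℂ))
    (l : Rstar) : schwartzField hη f l = toeplitz l (etaL2 η l 0) (hat (ofSchwartz f)).toBCF := by
  unfold schwartzField
  rw [BoundedContinuousFunction.coe_ofNormedAddCommGroup]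
  exact integral_nuIntegrand_eq_toeplitz hη l f

theorem norm_schwartzField_le {η : 𝓢(Rn n, ℂ)} (hη : ‖η.toLp 2 volume‖ = 1) (f : 𝓢(R2n n, ℂ)) :
    ‖schwartzField hη f‖ ≤ ‖ofSchwartz f‖ :=
  BoundedContinuousFunction.norm_ofNormedAddCommGroup_le _ (norm_nonneg _)
    (norm_integral_nuIntegrand_le_norm hη f)

theorem schwartzField_add {η : 𝓢(Rn n, ℂ)} (hη : ‖η.toLp 2 volume‖ = 1) (f g : 𝓢(R2n n, ℂ)) :
    schwartzField hη (f + g) = schwartzField hη f + schwartzField hη g := by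
  refine BoundedContinuousFunction.ext fun l => ?_
  have h : (hat (ofSchwartz (f + g))).toBCF
      = (hat (ofSchwartz f)).toBCF + (hat (ofSchwartz g)).toBCF := by
    rw [ofSchwartz_add f g, hat_add (ofSchwartz f) (ofSchwartz g)]
    rfl
  rw [BoundedContinuousFunction.add_apply, schwartzField_apply hη (f + g) l,
    schwartzField_apply hη f l, schwartzField_apply hη g l, h]
  exact toeplitz_add l (etaL2 η l 0) _ _

theorem schwartzField_smul {η : 𝓢(Rn n, ℂ)} (hη : ‖η.toLp 2 volume‖ = 1) (c : ℂ) (f : 𝓢(R2n n, ℂ)) :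
    schwartzField hη (c • f) = c • schwartzField hη f := by
  refine BoundedContinuousFunction.ext fun l => ?_
  have h : (hat (ofSchwartz (c • f))).toBCF = c • (hat (ofSchwartz f)).toBCF := by
    rw [ofSchwartz_smul c f, hat_smul c (ofSchwartz f)]
    rfl
  rw [BoundedContinuousFunction.smul_apply, schwartzField_apply hη (c • f) l,
    schwartzField_apply hη f l, h]
  exact toeplitz_smul l (etaL2 η l 0) c _

theorem norm_opFields (F : OpFields n) : ‖F‖ = max ‖valueZero F‖ ‖F.1.2‖ := rfl

theorem norm_valueZero_le (F : OpFields n) : ‖valueZero F‖ ≤ ‖F‖ :=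
  (le_max_left _ _).trans_eq (norm_opFields F).symm

/-- The map `ν` on Schwartz functions. -/
def nuSchwartz (hn : 1 ≤ n) {η : 𝓢(Rn n, ℂ)} (hη : ‖η.toLp 2 volume‖ = 1) :
    𝓢(R2n n, ℂ) →ₗ[ℂ] OpFields n where
  toFun f := ⟨(ofSchwartz f, schwartzField hη f),
    fun l => isCompactOperator_integral_nuIntegrand η l f,
    tendsto_integral_nuIntegrand_nearInfinity hn η f⟩
  map_add' f g := Subtype.ext (Prod.ext (ofSchwartz_add f g) (schwartzField_add hη f g))
  map_smul' c f := Subtype.ext (Prod.ext (ofSchwartz_smul c f) (schwartzField_smul hη c f))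

theorem norm_nuSchwartz_le (hn : 1 ≤ n) {η : 𝓢(Rn n, ℂ)} (hη : ‖η.toLp 2 volume‖ = 1)
    (f : 𝓢(R2n n, ℂ)) : ‖nuSchwartz hn hη f‖ ≤ 1 * ‖ofSchwartz f‖ := by
  refine le_of_le_of_eq ?_ (one_mul ‖ofSchwartz f‖).symm
  exact (norm_opFields (nuSchwartz hn hη f)).trans_le
    (max_le (le_refl ‖ofSchwartz f‖) (norm_schwartzField_le hη f))

/-- The embedding of the Schwartz functions into `C⋆(ℝ²ⁿ)` as a linear map. -/
def ofSchwartzₗ (n : ℕ) : 𝓢(R2n n, ℂ) →ₗ[ℂ] CStarR2n n where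
  toFun := ofSchwartz
  map_add' := ofSchwartz_add
  map_smul' := ofSchwartz_smul

/-- The map `ν`, extended by continuity from the Schwartz functions to `C⋆(ℝ²ⁿ)`. -/
def nu (hn : 1 ≤ n) {η : 𝓢(Rn n, ℂ)} (hη : ‖η.toLp 2 volume‖ = 1) : CStarR2n n →L[ℂ] OpFields n :=
  (nuSchwartz hn hη).extendOfNorm (ofSchwartzₗ n)

theorem nu_ofSchwartz (hn : 1 ≤ n) {η : 𝓢(Rn n, ℂ)} (hη : ‖η.toLp 2 volume‖ = 1) (f : 𝓢(R2n n, ℂ)) :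
    nu hn hη (ofSchwartz f) = nuSchwartz hn hη f :=
  LinearMap.extendOfNorm_eq (f := nuSchwartz hn hη) (e := ofSchwartzₗ n) denseRange_ofSchwartz
    ⟨1, norm_nuSchwartz_le hn hη⟩ f

theorem norm_nu_apply_le (hn : 1 ≤ n) {η : 𝓢(Rn n, ℂ)} (hη : ‖η.toLp 2 volume‖ = 1)
    (h : CStarR2n n) :
    ‖nu hn hη h‖ ≤ 1 * ‖h‖ :=
  LinearMap.norm_extendOfNorm_apply_le (f := nuSchwartz hn hη) (e := ofSchwartzₗ n)
    denseRange_ofSchwartz 1 (norm_nuSchwartz_le hn hη) h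

theorem continuous_valueZero : Continuous (valueZero (n := n)) :=
  continuous_fst.comp continuous_subtype_val

theorem continuous_valueAt (l : Rstar) : Continuous fun F : OpFields n => valueAt F l :=
  (BoundedContinuousFunction.lipschitz_eval_const l).continuous.comp
    (continuous_snd.comp continuous_subtype_val)

theorem continuous_toeplitz_hat {η : 𝓢(Rn n, ℂ)} (hη : ‖η.toLp 2 volume‖ = 1) (l : Rstar) :
    Continuous fun h : CStarR2n n => toeplitz l (etaL2 η l 0) (hat h).toBCF := by
  refine (LinearMap.mkContinuous
    ({ toFun := fun h => toeplitz l (etaL2 η l 0) (hat h).toBCF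
       map_add' := fun h h' => by
        rw [hat_add, ← toeplitz_add]
        rfl
       map_smul' := fun c h => by
        rw [hat_smul, RingHom.id_apply, ← toeplitz_smul]
        rfl } : CStarR2n n →ₗ[ℂ] (L2Rn n →L[ℂ] L2Rn n)) 1 fun h => ?_).continuous
  exact (norm_toeplitz_hat_le hη l h).trans (one_mul ‖h‖).ge

theorem valueZero_nu (hn : 1 ≤ n) {η : 𝓢(Rn n, ℂ)} (hη : ‖η.toLp 2 volume‖ = 1) (h : CStarR2n n) :
    valueZero (nu hn hη h) = h := by
  have h1 := DenseRange.equalizer denseRange_ofSchwartz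
    (continuous_valueZero.comp (nu hn hη).continuous) continuous_id
    (funext fun f => congrArg valueZero (nu_ofSchwartz hn hη f))
  exact congrFun h1 h

theorem valueAt_nu (hn : 1 ≤ n) {η : 𝓢(Rn n, ℂ)} (hη : ‖η.toLp 2 volume‖ = 1) (h : CStarR2n n)
    (l : Rstar) :
    valueAt (nu hn hη h) l = toeplitz l (etaL2 η l 0) (hat h).toBCF := by
  have h1 := DenseRange.equalizer denseRange_ofSchwartz
    ((continuous_valueAt l).comp (nu hn hη).continuous) (continuous_toeplitz_hat hη l)
    (funext fun f => (congrArg (fun F => valueAt F l) (nu_ofSchwartz hn hη f)).trans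
      (schwartzField_apply hη f l))
  exact congrFun h1 h

theorem nuOp_eq_toeplitz {η : 𝓢(Rn n, ℂ)} (hη : ‖η.toLp 2 volume‖ = 1) (l : Rstar)
    (h : CStarR2n n) :
    nuOp η l h = toeplitz l (etaL2 η l 0) (hat h).toBCF := by
  have := comap_nhds_neBot denseRange_ofSchwartz h
  refine Tendsto.limUnder_eq ?_
  have h1 := ((continuous_toeplitz_hat hη l).tendsto h).comp
    (tendsto_comap (f := ofSchwartz (n := n)))
  refine h1.congr fun f => ?_
  exact (integral_nuIntegrand_eq_toeplitz hη l f).symm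

/-- `C⋆(ℝ²ⁿ)` is not the zero algebra, because the Fourier transform of a nonzero Schwartz function
is nonzero. -/
instance : Nontrivial (CStarR2n n) := by
  let b : ContDiffBump (0 : R2n n) := ⟨1, 2, one_pos, one_lt_two⟩
  let g : 𝓢(R2n n, ℂ) := (b.hasCompactSupport.comp_left Complex.ofReal_zero).toSchwartzMap
    (Complex.ofRealCLM.contDiff.comp b.contDiff)
  have hg : g 0 = 1 := by
    change ((b 0 : ℝ) : ℂ) = 1
    rw [b.one_of_mem_closedBall (Metric.mem_closedBall_self b.rIn_pos.le), Complex.ofReal_one]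
  refine ⟨ofSchwartz (𝓕⁻ g), 0, fun h => one_ne_zero (α := ℂ) ?_⟩
  have h1 : hat (ofSchwartz (𝓕⁻ g)) 0 = g 0 := by
    rw [hat_ofSchwartz_apply, ← SchwartzMap.fourier_coe, FourierTransform.fourier_fourierInv_eq]
  have h2 : ‖hat (ofSchwartz (𝓕⁻ g))‖ = 0 := by
    rw [norm_hat, h, norm_zero]
  rw [← hg, ← h1, norm_eq_zero.1 h2]
  rfl

theorem norm_nu (hn : 1 ≤ n) {η : 𝓢(Rn n, ℂ)} (hη : ‖η.toLp 2 volume‖ = 1) : ‖nu hn hη‖ = 1 := by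
  refine le_antisymm ((nu hn hη).opNorm_le_bound zero_le_one (norm_nu_apply_le hn hη)) ?_
  obtain ⟨h, hh⟩ := exists_ne (0 : CStarR2n n)
  have h0 : ‖h‖ ≤ ‖nu hn hη h‖ :=
    (congrArg norm (valueZero_nu hn hη h)).symm.trans_le (norm_valueZero_le (nu hn hη h))
  have h1 : 1 * ‖h‖ ≤ ‖nu hn hη‖ * ‖h‖ :=
    (one_mul ‖h‖).trans_le (h0.trans ((nu hn hη).le_opNorm h))
  exact le_of_mul_le_mul_right h1 (norm_pos_iff.2 hh)

/-! ### Passage to the limit `λ → 0` -/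

/-- Asymptotic vanishing of a uniformly bounded family of additive maps may be tested on a dense
set. -/
theorem tendsto_zero_of_denseRange {X E F ι : Type*} [NormedAddCommGroup E] [NormedAddCommGroup F]
    {l : Filter ι} {e : X → E} (he : DenseRange e) {A : ι → E → F} {C : ℝ}
    (hsub : ∀ i x y, A i (x - y) = A i x - A i y) (hA : ∀ i x, ‖A i x‖ ≤ C * ‖x‖)
    (h : ∀ x, Tendsto (fun i => ‖A i (e x)‖) l (𝓝 0)) (y : E) :
    Tendsto (fun i => ‖A i y‖) l (𝓝 0) := by
  rw [Metric.tendsto_nhds]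
  intro ε hε
  obtain ⟨x, hx⟩ := he.exists_dist_lt y (ε := ε / (2 * (|C| + 1))) (by positivity)
  filter_upwards [Metric.tendsto_nhds.1 (h x) (ε / 2) (half_pos hε)] with i hi
  rw [dist_zero_right, norm_norm] at hi ⊢
  rw [dist_eq_norm, lt_div_iff₀ (by positivity)] at hx
  have h1 : ‖A i y - A i (e x)‖ ≤ (|C| + 1) * ‖y - e x‖ := by
    rw [← hsub]
    refine (hA i _).trans (mul_le_mul_of_nonneg_right ?_ (norm_nonneg _))
    linarith [le_abs_self C]
  have h2 := norm_add_le (A i y - A i (e x)) (A i (e x))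
  rw [sub_add_cancel] at h2
  linarith

theorem toBCF_hat_sub (h h' : CStarR2n n) :
    (hat (h - h')).toBCF = (hat h).toBCF - (hat h').toBCF := by
  rw [hat_sub]
  rfl

theorem toeplitz_sub (l : Rstar) (φ : L2Rn n) (g g' : R2n n →ᵇ ℂ) :
    toeplitz l φ (g - g') = toeplitz l φ g - toeplitz l φ g' := by
  rw [eq_sub_iff_add_eq, ← toeplitz_add, sub_add_cancel]

theorem tendsto_toeplitz_mul {η : 𝓢(Rn n, ℂ)} (hη : ‖η.toLp 2 volume‖ = 1) (h h' : CStarR2n n) :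
    Tendsto (fun l : Rstar => ‖toeplitz l (etaL2 η l 0) (hat (h * h')).toBCF -
      toeplitz l (etaL2 η l 0) (hat h).toBCF ∘L toeplitz l (etaL2 η l 0) (hat h').toBCF‖)
      nearZero (𝓝 0) := by
  have hn1 : ∀ l, ‖etaL2 η l 0‖ = 1 := fun l => (norm_etaL2_zero η l).trans hη
  refine tendsto_zero_of_denseRange denseRange_ofL1 (C := 2 * ‖h‖)
    (A := fun l h' => toeplitz l (etaL2 η l 0) (hat (h * h')).toBCF -
      toeplitz l (etaL2 η l 0) (hat h).toBCF ∘L toeplitz l (etaL2 η l 0) (hat h').toBCF)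
    (fun l x y => ?_) (fun l x => ?_) (fun f => ?_) h'
  · rw [mul_sub, toBCF_hat_sub, toBCF_hat_sub, toeplitz_sub, toeplitz_sub,
      ContinuousLinearMap.comp_sub]
    abel
  · have h1 := norm_toeplitz_hat_le hη l (h * x)
    have h2 : ‖toeplitz l (etaL2 η l 0) (hat h).toBCF ∘L
        toeplitz l (etaL2 η l 0) (hat x).toBCF‖ ≤ ‖h‖ * ‖x‖ :=
      (ContinuousLinearMap.opNorm_comp_le _ _).trans (mul_le_mul (norm_toeplitz_hat_le hη l h)
        (norm_toeplitz_hat_le hη l x) (norm_nonneg _) (norm_nonneg _))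
    have h3 := norm_mul_le h x
    refine (norm_sub_le _ _).trans ?_
    linarith
  · have hf := L1.integrable_coeFn f
    have h1 := (tendsto_defect hn1 (tendsto_dualShift_etaL2 η) hf).const_mul ‖(hat h).toBCF‖
    rw [mul_zero] at h1
    refine squeeze_zero (fun l => norm_nonneg _) (fun l => ?_) h1
    rw [toBCF_hat_mul]
    refine norm_toeplitz_mul_sub_le l (hn1 l) hf _ fun u => ?_
    rw [hat_ofL1]
    rfl

theorem tendsto_toeplitz_etaL2 {η : 𝓢(Rn n, ℂ)} (hη : ‖η.toLp 2 volume‖ = 1) (h : CStarR2n n)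
    (u : R2n n) :
    Tendsto (fun l : Rstar => ‖toeplitz l (etaL2 η l 0) (hat h).toBCF (etaL2 η l u) -
      hat h u • etaL2 η l u‖) nearZero (𝓝 0) := by
  have hn1 : ∀ l, ‖etaL2 η l 0‖ = 1 := fun l => (norm_etaL2_zero η l).trans hη
  have hn2 : ∀ l, ‖etaL2 η l u‖ = 1 := fun l => (norm_etaL2 η l u).trans hη
  refine tendsto_zero_of_denseRange denseRange_ofL1 (C := 2)
    (A := fun l h => toeplitz l (etaL2 η l 0) (hat h).toBCF (etaL2 η l u) -
      hat h u • etaL2 η l u)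
    (fun l x y => ?_) (fun l x => ?_) (fun f => ?_) h
  · rw [toBCF_hat_sub, toeplitz_sub, sub_apply, hat_sub, ZeroAtInftyContinuousMap.sub_apply,
      sub_smul]
    abel
  · have h1 := (toeplitz l (etaL2 η l 0) (hat x).toBCF).le_of_opNorm_le
      (norm_toeplitz_hat_le hη l x) (etaL2 η l u)
    have h2 : ‖hat x u‖ ≤ ‖x‖ := by
      rw [← norm_hat x, ← ZeroAtInftyContinuousMap.norm_toBCF_eq_norm]
      exact (hat x).toBCF.norm_coe_le_norm u
    rw [hn2, mul_one] at h1
    refine (norm_sub_le _ _).trans ?_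
    rw [norm_smul, hn2, mul_one]
    linarith
  · have hf := L1.integrable_coeFn f
    refine squeeze_zero (fun l => norm_nonneg _) (fun l => ?_)
      (tendsto_defect hn1 (tendsto_dualShift_etaL2 η) hf)
    have h1 := norm_toeplitz_tfShift_sub_le l (hn1 l) hf (g := (hat (ofL1 f)).toBCF)
      (fun v => by rw [hat_ofL1]; rfl) u
    rwa [← etaL2_eq_tfShift] at h1

/-- The lower bound for the norm comes from the approximate eigenvectors `η(λ, u)`. -/
theorem tendsto_norm_toeplitz {η : 𝓢(Rn n, ℂ)} (hη : ‖η.toLp 2 volume‖ = 1) (h : CStarR2n n) :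
    Tendsto (fun l : Rstar => ‖toeplitz l (etaL2 η l 0) (hat h).toBCF‖) nearZero (𝓝 ‖hat h‖) := by
  rw [Metric.tendsto_nhds]
  intro ε hε
  have hup : ∀ l, ‖toeplitz l (etaL2 η l 0) (hat h).toBCF‖ ≤ ‖hat h‖ := fun l =>
    (norm_toeplitz_hat_le hη l h).trans_eq (norm_hat h).symm
  obtain ⟨u, hu⟩ : ∃ u, ‖hat h‖ - ε / 2 < ‖hat h u‖ := by
    by_contra! hcon
    have hnn : 0 ≤ ‖hat h‖ - ε / 2 := (norm_nonneg _).trans (hcon 0)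
    have h1 := (BoundedContinuousFunction.norm_le (f := (hat h).toBCF) hnn).2 hcon
    rw [ZeroAtInftyContinuousMap.norm_toBCF_eq_norm] at h1
    linarith
  filter_upwards [Metric.tendsto_nhds.1 (tendsto_toeplitz_etaL2 hη h u) (ε / 2) (half_pos hε)]
    with l hl
  rw [dist_zero_right, norm_norm] at hl
  have hn2 : ‖etaL2 η l u‖ = 1 := (norm_etaL2 η l u).trans hη
  have h1 := (toeplitz l (etaL2 η l 0) (hat h).toBCF).le_opNorm (etaL2 η l u)
  have h2 := norm_sub_norm_le (hat h u • etaL2 η l u)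
    (toeplitz l (etaL2 η l 0) (hat h).toBCF (etaL2 η l u))
  rw [norm_sub_rev, norm_smul, hn2, mul_one] at h2
  rw [hn2, mul_one] at h1
  rw [Real.dist_eq, abs_lt]
  constructor
  · linarith
  · linarith [hup l]

end Nu

end HeisenbergCStar

end

open HeisenbergCStar in
theorem proposition2 (n : ℕ) (hn : 1 ≤ n) (η : 𝓢(Rn n, ℂ)) (hη : ‖η.toLp 2‖ = 1) :
    -- the map `ν` is well defined, linear and bounded, with values in `𝓕_n`
    ∃ ν : CStarR2n n →L[ℂ] OpFields n,
      (∀ h : CStarR2n n, valueZero (ν h) = h) ∧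
      (∀ (h : CStarR2n n) (l : Rstar), valueAt (ν h) l = nuOp η l h) ∧
      (∀ (f : 𝓢(R2n n, ℂ)) (l : Rstar), Integrable (nuIntegrand η l f) ∧
        valueAt (ν (ofSchwartz f)) l = ∫ u : R2n n, nuIntegrand η l f u) ∧
      -- (1)
      ‖ν‖ = 1 ∧
      -- (2)
      (∀ h h' : CStarR2n n, Tendsto
        (fun l : Rstar => ‖nuOp η l (h * h') - nuOp η l h ∘L nuOp η l h'‖) nearZero (𝓝 0)) ∧
      (∀ h : CStarR2n n, Tendsto
        (fun l : Rstar => ‖nuOp η l (star h) - star (nuOp η l h)‖) nearZero (𝓝 0)) ∧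
      -- (3)
      (∀ (h : CStarR2n n) (u : R2n n), Tendsto
        (fun l : Rstar => ‖valueAt (ν h) l (etaL2 η l u) - hat h u • etaL2 η l u‖) nearZero (𝓝 0)) ∧
      -- (4)
      (∀ h : CStarR2n n, Tendsto (fun l : Rstar => ‖valueAt (ν h) l‖) nearZero (𝓝 ‖hat h‖)) := by
  refine ⟨nu hn hη, valueZero_nu hn hη, fun h l => ?_,
    fun f l => ⟨integrable_nuIntegrand hη l f, ?_⟩, norm_nu hn hη,
    fun h h' => ?_, fun h => ?_, fun h u => ?_, fun h => ?_⟩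
  · rw [valueAt_nu, nuOp_eq_toeplitz hη]
  · rw [valueAt_nu, integral_nuIntegrand_eq_toeplitz hη]
  · simp only [nuOp_eq_toeplitz hη]
    exact tendsto_toeplitz_mul hη h h'
  · have h0 : ∀ l, ‖nuOp η l (star h) - star (nuOp η l h)‖ = 0 := fun l => by
      rw [nuOp_eq_toeplitz hη, nuOp_eq_toeplitz hη, toBCF_hat_star, star_toeplitz, sub_self,
        norm_zero]
    simp only [h0]
    exact tendsto_const_nhds
  · simp only [valueAt_nu]
    exact tendsto_toeplitz_etaL2 hη h u
  · simp only [valueAt_nu]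
    exact tendsto_norm_toeplitz hη h
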